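/- Let $R$ be a commutative unital ring. Algebras are associative and not necessarily unital; "universal" means universal among such $R$-algebras. An *ultragraph* $\mathcal G=(G^0,\mathcal G^1,r,s)$ consists of countable sets $G^0$ (vertices) and $\mathcal G^1$ (edges), a map $s:\mathcal G^1\to G^0$ and a map $r:\mathcal G^1\to \mathcal P(G^0)\setminus\{\emptyset\}$. A vertex $v$ is *regular* if $0<|s^{-1}(v)|<\infty$. Let $\mathcal G^0$ be the smallest family of subsets of $G^0$ that contains $\emptyset$, all $\{v\}$ ($v\in G^0$) and all $r(e)$ ($e\in\mathcal G^1$), and is closed under finite unions and finite intersections. The *Leavitt path algebra* $L_R(\mathcal G)$ is the universal $R$-algebra with generators $s_e,s_e^*$ ($e\in\mathcal G^1$) and $p_A$ ($A\in\mathcal G^0$) and relations 1. $p_\emptyset=0$, $p_Ap_B=p_{A\cap B}$, $p_{A\cup B}=p_A+p_B-p_{A\cap B}$ for $A,B\in\mathcal G^0$; 2. $p_{\{s(e)\}}s_e=s_ep_{r(e)}=s_e$ and $p_{r(e)}s_e^*=s_e^*p_{\{s(e)\}}=s_e^*$ for $e\in\mathcal G^1$; 3. $s_e^*s_f=\delta_{e,f}\,p_{r(e)}$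 for $e,f\in\mathcal G^1$; 4. $p_{\{v\}}=\sum_{s(e)=v}s_es_e^*$ for every regular vertex $v$. The *one-sided edge shift* $\mathsf X_{\mathcal G}\subseteq(\mathcal G^1)^{\mathbb N}$ is the set of all sequences of edges in which no word $ef$ with $s(f)\notin r(e)$ occurs. For a subshift $\mathsf X\subseteq \mathscr A^{\mathbb N}$ let $\mathcal L_{\mathsf X}$ be the set of finite words (including the empty word $\omega$) that occur in sequences of $\mathsf X$. For $\alpha,\beta\in\mathcal L_{\mathsf X}$ put $C(\alpha,\beta)=\{\beta x\in\mathsf X:\alpha x\in\mathsf X\}$, and let $\mathcal B$ be the family of subsets of $\mathsf X$ generated, under finite unions, finite intersections and relative complements (and containing $\emptyset$), by the sets $C(\alpha,\beta)$ with $\alpha,\beta\in\mathcal L_{\mathsf X}$ not both equal to $\omega$. For $\alpha=\alpha_1\cdots\alpha_n\neq\omega$ write $s_\alpha=s_{\alpha_1}\cdots s_{\alpha_n}$ and $s_\alpha^*=s_{\alpha_n}^*\cdots s_{\alpha_1}^*$. The *subshift algebra* $\mathcal A_R(\mathsf X)$ is the universal $R$-algebra with generators $p_A$ ($A\in\mathcal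 B$) and $s_a,s_a^*$ ($a\in\mathscr A$) and relations 1. $p_{A\cap B}=p_Ap_B$, $p_{A\cup B}=p_A+p_B-p_{A\cap B}$ and $p_\emptyset=0$ for $A,B\in\mathcal B$; 2. $s_as_a^*s_a=s_a$ and $s_a^*s_as_a^*=s_a^*$ for $a\in\mathscr A$; 3. $s_\beta s_\alpha^*s_\alpha s_\beta^*=p_{C(\alpha,\beta)}$, $s_\alpha^*s_\alpha=p_{C(\alpha,\omega)}$ and $s_\beta s_\beta^*=p_{C(\omega,\beta)}$ for $\alpha,\beta\in\mathcal L_{\mathsf X}\setminus\{\omega\}$. **Proposition.** Let $\mathcal G$ be an ultragraph in which every vertex is regular. Then $\mathcal A_R(\mathsf X_{\mathcal G})\cong L_R(\mathcal G)$ as $R$-algebras. -/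

import Mathlib

universe u v w

/-! ### Associative, not necessarily unital, algebras given by generators and relations -/

/-- The free associative non-unital `R`-algebra on a type `X` of generators: the semigroup
algebra of the free semigroup on `X` (non-commutative polynomials without constant term). -/
abbrev FreeNonUnitalAlg (R : Type u) [CommRing R] (X : Type v) : Type (max u v) :=
  MonoidAlgebra R (FreeSemigroup X)

/-- A generator, as an element of the free non-unital algebra. -/
noncomputable def FreeNonUnitalAlg.gen (R : Type u) [CommRing R] {X : Type v} (x : X) :
    FreeNonUnitalAlg R X :=
  MonoidAlgebra.single (FreeSemigroup.of x) (1 : R)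

/-- The smallest congruence on the free non-unital algebra that contains all scalar multiples of
the relations `rel`; see `presentedCon_smul` for its compatibility with scalars. -/
noncomputable def presentedCon (R : Type u) [CommRing R] {X : Type v}
    (rel : FreeNonUnitalAlg R X → FreeNonUnitalAlg R X → Prop) : RingCon (FreeNonUnitalAlg R X) :=
  ringConGen fun x y => ∃ (c : R) (a b : FreeNonUnitalAlg R X), rel a b ∧ x = c • a ∧ y = c • b

theorem presentedCon_smul {R : Type u} [CommRing R] {X : Type v}
    {rel : FreeNonUnitalAlg R X → FreeNonUnitalAlg R X → Prop} (c : R)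
    {x y : FreeNonUnitalAlg R X} (h : presentedCon R rel x y) :
    presentedCon R rel (c • x) (c • y) := by
  change RingConGen.Rel _ _ _ at h ⊢
  induction h with
  | of x y h =>
    obtain ⟨d, a, b, hab, rfl, rfl⟩ := h
    exact .of _ _ ⟨c * d, a, b, hab, smul_smul _ _ _, smul_smul _ _ _⟩
  | refl x => exact .refl _
  | symm _ ih => exact .symm ih
  | trans _ _ ih₁ ih₂ => exact .trans ih₁ ih₂
  | add _ _ ih₁ ih₂ => rw [smul_add, smul_add]; exact .add ih₁ ih₂
  | mul _ h₂ ih₁ _ => rw [← smul_mul_assoc, ← smul_mul_assoc]; exact .mul ih₁ h₂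

/-- The universal (associative, not necessarily unital) `R`-algebra with generators `X` and
relations `rel`. -/
def PresentedAlg (R : Type u) [CommRing R] {X : Type v}
    (rel : FreeNonUnitalAlg R X → FreeNonUnitalAlg R X → Prop) : Type (max u v) :=
  (presentedCon R rel).Quotient

namespace PresentedAlg

variable {R : Type u} [CommRing R] {X : Type v}
  {rel : FreeNonUnitalAlg R X → FreeNonUnitalAlg R X → Prop}

noncomputable instance : NonUnitalRing (PresentedAlg R rel) :=
  inferInstanceAs (NonUnitalRing (presentedCon R rel).Quotient)

/-- The quotient map from the free algebra. -/
noncomputable def mk (rel : FreeNonUnitalAlg R X → FreeNonUnitalAlg R X → Prop) (a : FreeNonUnitalAlg R X) :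
    PresentedAlg R rel :=
  ((a : (presentedCon R rel).Quotient) : (presentedCon R rel).Quotient)

theorem mk_surjective : Function.Surjective (mk rel) := fun x =>
  Quotient.inductionOn' x fun a => ⟨a, rfl⟩

noncomputable instance : SMul R (PresentedAlg R rel) where
  smul c := Quotient.map' (fun a => c • a) fun _ _ h => presentedCon_smul c h

theorem mk_smul (c : R) (a : FreeNonUnitalAlg R X) : mk rel (c • a) = c • mk rel a := rfl

theorem mk_add (a b : FreeNonUnitalAlg R X) : mk rel (a + b) = mk rel a + mk rel b := rfl

theorem mk_mul (a b : FreeNonUnitalAlg R X) : mk rel (a * b) = mk rel a * mk rel b := rfl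

theorem mk_zero : mk rel 0 = 0 := rfl

noncomputable instance : Module R (PresentedAlg R rel) :=
  Function.Surjective.module R
    (⟨⟨mk rel, mk_zero⟩, mk_add⟩ : FreeNonUnitalAlg R X →+ PresentedAlg R rel)
    mk_surjective mk_smul

instance : IsScalarTower R (PresentedAlg R rel) (PresentedAlg R rel) where
  smul_assoc c x y := by
    obtain ⟨a, rfl⟩ := mk_surjective x
    obtain ⟨b, rfl⟩ := mk_surjective y
    simp only [smul_eq_mul, ← mk_smul, ← mk_mul, smul_mul_assoc]

instance : SMulCommClass R (PresentedAlg R rel) (PresentedAlg R rel) where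
  smul_comm c x y := by
    obtain ⟨a, rfl⟩ := mk_surjective x
    obtain ⟨b, rfl⟩ := mk_surjective y
    simp only [smul_eq_mul, ← mk_smul, ← mk_mul, mul_smul_comm]

end PresentedAlg

/-! ### One-sided subshifts and their algebras

A point of the full shift over the alphabet `A` is an element of `Stream' A`, that is, a sequence
`ℕ → A`; a finite word is an element of `List A`. -/

namespace Subshift

variable {A : Type v}

/-- The subshift of all sequences in which no word of `F` occurs. -/
def ofForbidden (F : Set (List A)) : Set (Stream' A) :=
  {x | ∀ w ∈ F, ∀ i : ℕ, (x.drop i).take w.length ≠ w}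

/-- The language of `X`: the finite words with which a sequence of `X` begins. -/
def language (X : Set (Stream' A)) : Set (List A) :=
  {w | ∃ x ∈ X, x.take w.length = w}

/-- `C(α, β) = {βx ∈ X : αx ∈ X}`. -/
def C (X : Set (Stream' A)) (α β : List A) : Set (Stream' A) :=
  {y | y ∈ X ∧ ∃ x : Stream' A, y = β ++ₛ x ∧ α ++ₛ x ∈ X}

/-- Membership in the Boolean algebra (with relative complements, not necessarily with a top
element) of subsets of `X` generated by the sets `C(α, β)`, for `α`, `β` in the language of `X`
that are not both empty. -/
inductive InB (X : Set (Stream' A)) : Set (Stream' A) → Prop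
  | basic (α β : List A) (hα : α ∈ language X) (hβ : β ∈ language X)
      (h : ¬(α = [] ∧ β = [])) : InB X (C X α β)
  | empty : InB X ∅
  | union {S T : Set (Stream' A)} : InB X S → InB X T → InB X (S ∪ T)
  | inter {S T : Set (Stream' A)} : InB X S → InB X T → InB X (S ∩ T)
  | sdiff {S T : Set (Stream' A)} : InB X S → InB X T → InB X (S \ T)

/-- The generators `p_S` (`S` in the Boolean algebra), `s_a` and `s_a^*` (`a` a letter). -/
inductive Gen (X : Set (Stream' A)) : Type v
  | proj (S : Set (Stream' A)) (hS : InB X S) : Gen X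
  | s (a : A) : Gen X
  | sStar (a : A) : Gen X

/-- `f a₁ * f a₂ * ⋯ * f aₙ` for the non-empty word `a₁ a₂ … aₙ`, given as its first letter and
the list of the others. -/
def wordProd {M : Type w} [Mul M] (f : A → M) : A → List A → M
  | a, [] => f a
  | a, b :: l => f a * wordProd f b l

/-- `f aₙ * ⋯ * f a₂ * f a₁` for the non-empty word `a₁ a₂ … aₙ`, given as its first letter and
the list of the others. -/
def revWordProd {M : Type w} [Mul M] (f : A → M) : A → List A → M
  | a, [] => f a
  | a, b :: l => revWordProd f b l * f a

section Relations

variable (R : Type u) [CommRing R] (X : Set (Stream' A))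

/-- `p_S` in the free algebra. -/
noncomputable def p (S : Set (Stream' A)) (hS : InB X S) : FreeNonUnitalAlg R (Gen X) :=
  FreeNonUnitalAlg.gen R (Gen.proj S hS)

/-- `s_a` in the free algebra. -/
noncomputable def s (a : A) : FreeNonUnitalAlg R (Gen X) :=
  FreeNonUnitalAlg.gen R (Gen.s a)

/-- `s_a^*` in the free algebra. -/
noncomputable def sStar (a : A) : FreeNonUnitalAlg R (Gen X) :=
  FreeNonUnitalAlg.gen R (Gen.sStar a)

/-- `s_α = s_{α₁} ⋯ s_{αₙ}` for the non-empty word `α = a :: l`. -/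
noncomputable def sWord (a : A) (l : List A) : FreeNonUnitalAlg R (Gen X) :=
  wordProd (s R X) a l

/-- `s_α^* = s_{αₙ}^* ⋯ s_{α₁}^*` for the non-empty word `α = a :: l`. -/
noncomputable def sWordStar (a : A) (l : List A) : FreeNonUnitalAlg R (Gen X) :=
  revWordProd (sStar R X) a l

/-- The defining relations of the subshift algebra. -/
inductive Rel : FreeNonUnitalAlg R (Gen X) → FreeNonUnitalAlg R (Gen X) → Prop
  | proj_inter (S T : Set (Stream' A)) (hS : InB X S) (hT : InB X T) :
      Rel (p R X (S ∩ T) (hS.inter hT)) (p R X S hS * p R X T hT)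
  | proj_union (S T : Set (Stream' A)) (hS : InB X S) (hT : InB X T) :
      Rel (p R X (S ∪ T) (hS.union hT))
        (p R X S hS + p R X T hT - p R X (S ∩ T) (hS.inter hT))
  | proj_empty : Rel (p R X ∅ InB.empty) 0
  | s_sStar_s (a : A) : Rel (s R X a * sStar R X a * s R X a) (s R X a)
  | sStar_s_sStar (a : A) : Rel (sStar R X a * s R X a * sStar R X a) (sStar R X a)
  | word_word (a : A) (l : List A) (b : A) (m : List A)
      (hα : a :: l ∈ language X) (hβ : b :: m ∈ language X) :
      Rel (sWord R X b m * sWordStar R X a l * sWord R X a l * sWordStar R X b m)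
        (p R X (C X (a :: l) (b :: m)) (InB.basic _ _ hα hβ (by simp)))
  | word_empty (a : A) (l : List A) (hα : a :: l ∈ language X) (hω : [] ∈ language X) :
      Rel (sWordStar R X a l * sWord R X a l)
        (p R X (C X (a :: l) []) (InB.basic _ _ hα hω (by simp)))
  | empty_word (b : A) (m : List A) (hβ : b :: m ∈ language X) (hω : [] ∈ language X) :
      Rel (sWord R X b m * sWordStar R X b m)
        (p R X (C X [] (b :: m)) (InB.basic _ _ hω hβ (by simp)))

end Relations

/-- The (not necessarily unital) subshift algebra of `X` with coefficients in `R`. -/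
abbrev algebra (R : Type u) [CommRing R] (X : Set (Stream' A)) : Type (max u v) :=
  PresentedAlg R (Rel R X)

end Subshift

/-! ### Ultragraphs and their Leavitt path algebras -/

/-- An ultragraph with vertex set `V` and edge set `E`: both sets are countable, the source of an
edge is a vertex, and the range of an edge is a non-empty set of vertices. -/
structure Ultragraph (V : Type v) (E : Type w) where
  countable_vertices : Countable V
  countable_edges : Countable E
  source : E → V
  range : E → Set V
  range_nonempty : ∀ e, (range e).Nonempty

namespace Ultragraph

variable {V : Type v} {E : Type w} (G : Ultragraph V E)

/-- A vertex is regular if it emits at least one and at most finitely many edges. -/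
def IsRegular (x : V) : Prop :=
  {e | G.source e = x}.Nonempty ∧ {e | G.source e = x}.Finite

/-- The generalised vertices: the smallest family of sets of vertices that contains the singletons,
the ranges of the edges and the empty set and is closed under finite unions and intersections. -/
inductive IsGenVertex : Set V → Prop
  | singleton (x : V) : IsGenVertex {x}
  | range (e : E) : IsGenVertex (G.range e)
  | empty : IsGenVertex ∅
  | union {S T : Set V} : IsGenVertex S → IsGenVertex T → IsGenVertex (S ∪ T)
  | inter {S T : Set V} : IsGenVertex S → IsGenVertex T → IsGenVertex (S ∩ T)

/-- The one-sided edge subshift, over the alphabet of edges: the word `ef` is forbidden if the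
source of `f` does not lie in the range of `e`. -/
def edgeShift : Set (Stream' E) :=
  Subshift.ofForbidden {w | ∃ e f : E, w = [e, f] ∧ G.source f ∉ G.range e}

/-- The generators `p_S` (`S` a generalised vertex), `s_e` and `s_e^*` (`e` an edge). -/
inductive Gen : Type (max v w)
  | proj (S : Set V) (hS : G.IsGenVertex S) : Gen
  | s (e : E) : Gen
  | sStar (e : E) : Gen

section Relations

variable (R : Type u) [CommRing R]

/-- `p_S` in the free algebra. -/
noncomputable def p (S : Set V) (hS : G.IsGenVertex S) : FreeNonUnitalAlg R G.Gen :=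
  FreeNonUnitalAlg.gen R (Gen.proj S hS)

/-- `s_e` in the free algebra. -/
noncomputable def s (e : E) : FreeNonUnitalAlg R G.Gen :=
  FreeNonUnitalAlg.gen R (Gen.s e)

/-- `s_e^*` in the free algebra. -/
noncomputable def sStar (e : E) : FreeNonUnitalAlg R G.Gen :=
  FreeNonUnitalAlg.gen R (Gen.sStar e)

/-- The defining relations of the Leavitt path algebra of an ultragraph. -/
inductive Rel : FreeNonUnitalAlg R G.Gen → FreeNonUnitalAlg R G.Gen → Prop
  | proj_empty : Rel (G.p R ∅ .empty) 0
  | proj_inter (S T : Set V) (hS : G.IsGenVertex S) (hT : G.IsGenVertex T) :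
      Rel (G.p R S hS * G.p R T hT) (G.p R (S ∩ T) (hS.inter hT))
  | proj_union (S T : Set V) (hS : G.IsGenVertex S) (hT : G.IsGenVertex T) :
      Rel (G.p R (S ∪ T) (hS.union hT))
        (G.p R S hS + G.p R T hT - G.p R (S ∩ T) (hS.inter hT))
  | source_s (e : E) : Rel (G.p R {G.source e} (.singleton _) * G.s R e) (G.s R e)
  | s_range (e : E) : Rel (G.s R e * G.p R (G.range e) (.range e)) (G.s R e)
  | range_sStar (e : E) : Rel (G.p R (G.range e) (.range e) * G.sStar R e) (G.sStar R e)
  | sStar_source (e : E) : Rel (G.sStar R e * G.p R {G.source e} (.singleton _)) (G.sStar R e)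
  | sStar_s_same (e : E) : Rel (G.sStar R e * G.s R e) (G.p R (G.range e) (.range e))
  | sStar_s_ne (e f : E) (h : e ≠ f) : Rel (G.sStar R e * G.s R f) 0
  | vertex (x : V) (h : G.IsRegular x) :
      Rel (G.p R {x} (.singleton x)) (∑ e ∈ h.2.toFinset, G.s R e * G.sStar R e)

end Relations

/-- The Leavitt path algebra of the ultragraph `G` with coefficients in `R`. -/
abbrev leavittPathAlgebra (R : Type u) [CommRing R] : Type (max u v w) :=
  PresentedAlg R (Rel G R)

end Ultragraph

/-! Both algebras contain the elements s_e and s_e^*; the work lies in matching the projections. For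
α in the language, α and β not both empty, C(α, β) is a cylinder Z(β, A), the set of points βx with
s(x) ∈ A, where A is the range of the last letter of α (of β if α is empty). In any ring that
carries the Leavitt relations (`LeavittFamily`) its counterpart is s_β p_A s_β^*, and all these
elements are commuting idempotents.

From the Leavitt path algebra to the subshift algebra, p_A goes to the projection of Z(ω, A). This
set lies in the Boolean algebra because Z(ω, {v}) is the finite disjoint union of the C(ω, e) with
s(e) = v; the same decomposition yields the vertex relation (`subshiftFamily`).

In the other direction the projection of S must go to the value, on the elements s_β p_A s_β^*, of
some Boolean expression for S. The heart of the proof is that this value depends on S only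
(`boolRep_unique`).

That rests on two facts. First, it is enough that ∏ e_i ∏ (1 - e_j) vanishes whenever a nonempty
finite intersection of sets Z_i is covered by finitely many Z_j (`CoverCompatible`). Indeed, a
nonzero value x of an expression for ∅ is a nonzero idempotent in a commutative ring, hence lies
outside some prime ideal. Modulo that prime each e_i is 0 or 1. If all are 0, so is x; otherwise the
vanishing condition gives the finite intersection property, and an ultrafilter shows that x is 0
there, a contradiction (`eq_zero_of_empty`).

Second, the cylinders satisfy this condition (`coverCompatible`), by induction on the length of the
words. Moving such a product x past s_f strips the letter f from every word, so x s_f = 0 by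
induction, and x p_{v} = ∑ x s_e s_e^* = 0 at every vertex v. As p_A need not be a finite sum of
vertex projections, the last step covers A by finitely many generalised vertices whose projections x
kills.

The two homomorphisms are inverse to each other on generators: evaluating Boolean expressions
commutes with homomorphisms, and values are unique. -/

/-! ### Universal properties of free and presented algebras. -/

namespace FreeNonUnitalAlg

variable {R : Type u} [CommRing R] {X : Type v} {B : Type w} [NonUnitalRing B] [Module R B]
  [IsScalarTower R B B] [SMulCommClass R B B]

/-- The homomorphism from the free non-unital algebra given by the images of the generators. -/
noncomputable def lift (f : X → B) : FreeNonUnitalAlg R X →ₙₐ[R] B :=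
  MonoidAlgebra.liftMagma R (FreeSemigroup.lift f)

@[simp]
theorem lift_gen (f : X → B) (x : X) : lift (R := R) f (gen R x) = f x := by
  simp [lift, gen, MonoidAlgebra.liftMagma]

omit [IsScalarTower R B B] [SMulCommClass R B B] in
theorem hom_ext {f g : FreeNonUnitalAlg R X →ₙₐ[R] B} (h : ∀ x, f (gen R x) = g (gen R x)) :
    f = g := by
  apply MonoidAlgebra.nonUnitalAlgHom_ext'
  apply FreeSemigroup.hom_ext
  funext x
  exact h x

end FreeNonUnitalAlg

namespace PresentedAlg

variable {R : Type u} [CommRing R] {X : Type v}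
  {rel : FreeNonUnitalAlg R X → FreeNonUnitalAlg R X → Prop}
  {B : Type w} [NonUnitalRing B] [Module R B] [IsScalarTower R B B] [SMulCommClass R B B]

omit [IsScalarTower R B B] [SMulCommClass R B B] in
theorem map_eq_of_presentedCon (f : FreeNonUnitalAlg R X →ₙₐ[R] B)
    (hf : ∀ a b, rel a b → f a = f b) {x y : FreeNonUnitalAlg R X}
    (h : presentedCon R rel x y) : f x = f y := by
  change RingConGen.Rel _ _ _ at h
  induction h with
  | of x y h =>
    obtain ⟨c, a, b, hab, rfl, rfl⟩ := h
    rw [map_smul, map_smul, hf a b hab]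
  | refl x => rfl
  | symm _ ih => exact ih.symm
  | trans _ _ ih₁ ih₂ => exact ih₁.trans ih₂
  | add _ _ ih₁ ih₂ => rw [map_add, map_add, ih₁, ih₂]
  | mul _ _ ih₁ ih₂ => rw [map_mul, map_mul, ih₁, ih₂]

theorem mk_eq_of_rel {a b : FreeNonUnitalAlg R X} (h : rel a b) : mk rel a = mk rel b :=
  Quotient.sound' (RingConGen.Rel.of _ _ ⟨1, a, b, h, (one_smul _ _).symm, (one_smul _ _).symm⟩)

variable (rel) in
/-- The quotient map as a homomorphism of algebras. -/
noncomputable def mkHom : FreeNonUnitalAlg R X →ₙₐ[R] PresentedAlg R rel where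
  toFun := mk rel
  map_smul' := mk_smul
  map_zero' := mk_zero
  map_add' := mk_add
  map_mul' := mk_mul

@[simp]
theorem mkHom_apply (a : FreeNonUnitalAlg R X) : mkHom rel a = mk rel a := rfl

/-- The universal property of an algebra given by generators and relations. -/
noncomputable def lift (f : FreeNonUnitalAlg R X →ₙₐ[R] B) (hf : ∀ a b, rel a b → f a = f b) :
    PresentedAlg R rel →ₙₐ[R] B where
  toFun x := Quotient.liftOn' x f fun _ _ h => map_eq_of_presentedCon f hf h
  map_smul' c x := by
    obtain ⟨a, rfl⟩ := mk_surjective x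
    exact map_smul f c a
  map_zero' := map_zero f
  map_add' x y := by
    obtain ⟨a, rfl⟩ := mk_surjective x
    obtain ⟨b, rfl⟩ := mk_surjective y
    exact map_add f a b
  map_mul' x y := by
    obtain ⟨a, rfl⟩ := mk_surjective x
    obtain ⟨b, rfl⟩ := mk_surjective y
    exact map_mul f a b

omit [IsScalarTower R B B] [SMulCommClass R B B] in
@[simp]
theorem lift_mk (f : FreeNonUnitalAlg R X →ₙₐ[R] B) (hf : ∀ a b, rel a b → f a = f b)
    (a : FreeNonUnitalAlg R X) : lift f hf (mk rel a) = f a := rfl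

omit [IsScalarTower R B B] [SMulCommClass R B B] in
theorem hom_ext {f g : PresentedAlg R rel →ₙₐ[R] B}
    (h : ∀ x, f (mk rel (FreeNonUnitalAlg.gen R x)) = g (mk rel (FreeNonUnitalAlg.gen R x))) :
    f = g := by
  have H : f.comp (mkHom rel) = g.comp (mkHom rel) := FreeNonUnitalAlg.hom_ext h
  ext x
  obtain ⟨a, rfl⟩ := mk_surjective x
  exact DFunLike.congr_fun H a

end PresentedAlg

/-! ### Boolean expressions in idempotents and the uniqueness of their values. -/

/-- `BoolRep Z e S x` says that some expression in unions, intersections and differences takes the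
value `S` on the sets `Z i` and the value `x` on the elements `e i`, where a union, an intersection
and a difference are read as `x + y - x * y`, `x * y` and `x - x * y`. -/
inductive BoolRep {ι : Type u} {Ω : Type v} {T : Type w} [NonUnitalRing T]
    (Z : ι → Set Ω) (e : ι → T) : Set Ω → T → Prop
  | basic (i : ι) : BoolRep Z e (Z i) (e i)
  | empty : BoolRep Z e ∅ 0
  | union {S S' : Set Ω} {x y : T} : BoolRep Z e S x → BoolRep Z e S' y →
      BoolRep Z e (S ∪ S') (x + y - x * y)
  | inter {S S' : Set Ω} {x y : T} : BoolRep Z e S x → BoolRep Z e S' y →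
      BoolRep Z e (S ∩ S') (x * y)
  | sdiff {S S' : Set Ω} {x y : T} : BoolRep Z e S x → BoolRep Z e S' y →
      BoolRep Z e (S \ S') (x - x * y)

namespace BoolRep

variable {ι : Type u} {Ω : Type v} {T : Type w} [NonUnitalRing T] {Z : ι → Set Ω} {e : ι → T}

theorem of_basic {κ : Type*} {Z' : κ → Set Ω} {e' : κ → T}
    (h : ∀ k, BoolRep Z e (Z' k) (e' k)) {S : Set Ω} {x : T} (H : BoolRep Z' e' S x) :
    BoolRep Z e S x := by
  induction H with
  | basic i => exact h i
  | empty => exact .empty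
  | union _ _ h₁ h₂ => exact .union h₁ h₂
  | inter _ _ h₁ h₂ => exact .inter h₁ h₂
  | sdiff _ _ h₁ h₂ => exact .sdiff h₁ h₂

theorem map {T' : Type*} [NonUnitalRing T'] (f : T →ₙ+* T') {S : Set Ω} {x : T}
    (H : BoolRep Z e S x) : BoolRep Z (fun i => f (e i)) S (f x) := by
  induction H with
  | basic i => exact .basic i
  | empty => rw [map_zero]; exact .empty
  | union _ _ h₁ h₂ => rw [map_sub, map_add, map_mul]; exact .union h₁ h₂
  | inter _ _ h₁ h₂ => rw [map_mul]; exact .inter h₁ h₂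
  | sdiff _ _ h₁ h₂ => rw [map_sub, map_mul]; exact .sdiff h₁ h₂

/-- This pulls an expression back to a subring that contains the `e i`, so that uniqueness can be
proved in a commutative ring. -/
theorem exists_of_map {T' : Type*} [NonUnitalRing T'] (f : T →ₙ+* T') {S : Set Ω} {y : T'}
    (H : BoolRep Z (fun i => f (e i)) S y) : ∃ x, f x = y ∧ BoolRep Z e S x := by
  induction H with
  | basic i => exact ⟨_, rfl, .basic i⟩
  | empty => exact ⟨0, map_zero f, .empty⟩
  | union _ _ h₁ h₂ =>
    obtain ⟨a, rfl, ha⟩ := h₁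
    obtain ⟨b, rfl, hb⟩ := h₂
    exact ⟨_, by rw [map_sub, map_add, map_mul], .union ha hb⟩
  | inter _ _ h₁ h₂ =>
    obtain ⟨a, rfl, ha⟩ := h₁
    obtain ⟨b, rfl, hb⟩ := h₂
    exact ⟨_, by rw [map_mul], .inter ha hb⟩
  | sdiff _ _ h₁ h₂ =>
    obtain ⟨a, rfl, ha⟩ := h₁
    obtain ⟨b, rfl, hb⟩ := h₂
    exact ⟨_, by rw [map_sub, map_mul], .sdiff ha hb⟩

end BoolRep

/-- Every finite empty Boolean combination of the sets `Z i`, with at least one of them occurring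
positively, corresponds to a vanishing product of the elements `e i` and `1 - e i`. -/
def CoverCompatible {ι : Type u} {Ω : Type v} {T : Type w} [Ring T]
    (Z : ι → Set Ω) (e : ι → T) : Prop :=
  ∀ l m : List ι, l ≠ [] → (∀ ω, (∀ i ∈ l, ω ∈ Z i) → ∃ j ∈ m, ω ∈ Z j) →
    (l.map e).prod * (m.map fun j => 1 - e j).prod = 0

namespace BoolRep

variable {ι : Type u} {Ω : Type v}

theorem isIdempotentElem {T : Type w} [CommRing T] {Z : ι → Set Ω} {e : ι → T}
    (he : ∀ i, IsIdempotentElem (e i)) {S : Set Ω} {x : T} (H : BoolRep Z e S x) :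
    IsIdempotentElem x := by
  induction H with
  | basic i => exact he i
  | empty => exact .zero
  | union _ _ h₁ h₂ =>
    exact h₁.add_sub_mul h₂
  | inter _ _ h₁ h₂ => exact h₁.mul h₂
  | sdiff _ _ h₁ h₂ =>
    rw [← mul_one_sub]
    exact h₁.mul h₂.one_sub

/-- A homomorphism to a domain singles out an ultrafilter of sets whose representatives it maps
to `1`. -/
theorem exists_ultrafilter {T : Type w} [CommRing T] {Z : ι → Set Ω} {e : ι → T}
    (he : ∀ i, IsIdempotentElem (e i)) (hc : CoverCompatible Z e)
    {K : Type*} [CommRing K] [IsDomain K] (χ : T →+* K) (i₀ : ι) (hi₀ : χ (e i₀) = 1) :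
    ∃ U : Ultrafilter Ω, ∀ i, (Z i ∈ U → χ (e i) = 1) ∧ (Z i ∉ U → χ (e i) = 0) := by
  have h01 : ∀ i, χ (e i) = 0 ∨ χ (e i) = 1 := fun i =>
    IsIdempotentElem.iff_eq_zero_or_one.1 ((he i).map χ)
  let 𝓕 : Set (Set Ω) := {S | ∃ i, χ (e i) = 1 ∧ S = Z i} ∪ {S | ∃ i, χ (e i) = 0 ∧ S = (Z i)ᶜ}
  have hne : (Filter.generate 𝓕).NeBot := by
    rw [Filter.generate_neBot_iff]
    intro t ht hfin
    -- A finite part of the generating family is described by a list of positive and a list of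
    -- negative indices, which is the form that `CoverCompatible` takes.
    have key : ∃ l m : List ι, (∀ i ∈ l, χ (e i) = 1) ∧ (∀ i ∈ m, χ (e i) = 0) ∧
        ∀ ω, (∀ i ∈ l, ω ∈ Z i) → (∀ i ∈ m, ω ∉ Z i) → ω ∈ ⋂₀ t := by
      induction t, hfin using Set.Finite.induction_on with
      | empty => exact ⟨[], [], by simp⟩
      | @insert S t _ _ ih =>
        obtain ⟨l, m, hl, hm, h⟩ := ih ((Set.subset_insert _ _).trans ht)
        rcases ht (Set.mem_insert _ _) with ⟨i, hi, rfl⟩ | ⟨i, hi, rfl⟩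
        · refine ⟨i :: l, m, by simpa [hi] using hl, hm, fun ω h1 h2 => ?_⟩
          rw [Set.sInter_insert]
          exact ⟨h1 i (by simp), h ω (fun j hj => h1 j (by simp [hj])) h2⟩
        · refine ⟨l, i :: m, hl, by simpa [hi] using hm, fun ω h1 h2 => ?_⟩
          rw [Set.sInter_insert]
          exact ⟨h2 i (by simp), h ω h1 (fun j hj => h2 j (by simp [hj]))⟩
    obtain ⟨l, m, hl, hm, h⟩ := key
    by_contra hemp
    rw [Set.not_nonempty_iff_eq_empty] at hemp
    -- Prepending `i₀` makes the positive list nonempty and does not change the value 1 of the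
    -- product under `χ`.
    have h0 := hc (i₀ :: l) m (by simp) fun ω hω => by
      by_contra! hcon
      have := h ω (fun i hi => hω i (by simp [hi])) hcon
      rw [hemp] at this
      exact this
    have h1 := congrArg χ h0
    rw [map_mul, map_list_prod, map_list_prod, map_zero, List.prod_eq_one, List.prod_eq_one] at h1
    · simp at h1
    · simp only [List.map_map, List.mem_map, Function.comp_apply, map_sub, map_one]
      rintro _ ⟨j, hj, rfl⟩
      rw [hm j hj, sub_zero]
    · simp only [List.map_map, List.mem_map, Function.comp_apply, List.mem_cons]
      rintro _ ⟨j, rfl | hj, rfl⟩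
      · exact hi₀
      · exact hl j hj
  refine ⟨Ultrafilter.of (Filter.generate 𝓕), fun i => ?_⟩
  have hle : ∀ S ∈ 𝓕, S ∈ Ultrafilter.of (Filter.generate 𝓕) := fun S hS =>
    Ultrafilter.of_le _ (Filter.mem_generate_of_mem hS)
  rcases h01 i with h | h
  · have : Z i ∉ Ultrafilter.of (Filter.generate 𝓕) :=
      Ultrafilter.compl_mem_iff_notMem.1 (hle _ (Or.inr ⟨i, h, rfl⟩))
    exact ⟨fun h' => absurd h' this, fun _ => h⟩
  · have : Z i ∈ Ultrafilter.of (Filter.generate 𝓕) := hle _ (Or.inl ⟨i, h, rfl⟩)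
    exact ⟨fun _ => h, fun h' => absurd this h'⟩

/-- Membership in an ultrafilter respects unions, intersections and differences exactly as the
values 0 and 1 do. -/
theorem map_eq_of_ultrafilter {T : Type w} [NonUnitalRing T] {Z : ι → Set Ω} {e : ι → T}
    {K : Type*} [Ring K] (χ : T →ₙ+* K) (U : Ultrafilter Ω)
    (hU : ∀ i, (Z i ∈ U → χ (e i) = 1) ∧ (Z i ∉ U → χ (e i) = 0)) {S : Set Ω} {x : T}
    (H : BoolRep Z e S x) : (S ∈ U → χ x = 1) ∧ (S ∉ U → χ x = 0) := by
  induction H with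
  | basic i => exact hU i
  | empty => exact ⟨fun h => absurd h U.empty_notMem, fun _ => map_zero χ⟩
  | @union S S' x y _ _ h₁ h₂ =>
    rw [Ultrafilter.union_mem_iff, map_sub, map_add, map_mul]
    by_cases hS : S ∈ U <;> by_cases hS' : S' ∈ U <;> simp_all
  | @inter S S' x y _ _ h₁ h₂ =>
    have : S ∩ S' ∈ U ↔ S ∈ U ∧ S' ∈ U := Filter.inter_mem_iff
    rw [this, map_mul]
    by_cases hS : S ∈ U <;> by_cases hS' : S' ∈ U <;> simp_all
  | @sdiff S S' x y _ _ h₁ h₂ =>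
    have : S \ S' ∈ U ↔ S ∈ U ∧ S' ∉ U := by
      rw [Set.sdiff_eq, ← Ultrafilter.compl_mem_iff_notMem]
      exact Filter.inter_mem_iff
    rw [this, map_sub, map_mul]
    by_cases hS : S ∈ U <;> by_cases hS' : S' ∈ U <;> simp_all

/-- Boolean expressions have no constant 1. This covers the primes that contain every `e i`, for
which no positive index is available. -/
theorem map_eq_zero_of_basic {T K : Type*} [NonUnitalRing T] [NonUnitalRing K] {Z : ι → Set Ω}
    {e : ι → T} (χ : T →ₙ+* K) (hχ : ∀ i, χ (e i) = 0) {S : Set Ω} {x : T}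
    (H : BoolRep Z e S x) : χ x = 0 := by
  induction H with
  | basic i => exact hχ i
  | empty => exact map_zero χ
  | union _ _ h₁ h₂ => simp [h₁, h₂]
  | inter _ _ h₁ h₂ => simp [h₁]
  | sdiff _ _ h₁ h₂ => simp [h₁]

theorem eq_zero_of_empty {T : Type w} [CommRing T] {Z : ι → Set Ω} {e : ι → T}
    (he : ∀ i, IsIdempotentElem (e i)) (hc : CoverCompatible Z e) {x : T}
    (H : BoolRep Z e ∅ x) : x = 0 := by
  by_contra hx
  have hnil : ¬ IsNilpotent x := by
    rintro ⟨n, hn⟩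
    rcases Nat.eq_zero_or_pos n with rfl | hpos
    · rw [pow_zero] at hn
      exact hx (by rw [← one_mul x, hn, zero_mul])
    · rw [(H.isIdempotentElem he).pow_eq hpos.ne'] at hn
      exact hx hn
  -- A nonzero idempotent is not nilpotent, so some prime ideal avoids it.
  rw [← mem_nilradical, nilradical_eq_sInf, Ideal.mem_sInf] at hnil
  push Not at hnil
  obtain ⟨I, hI, hxI⟩ := hnil
  have hI : I.IsPrime := hI
  let χ := Ideal.Quotient.mk I
  have hχ : χ x ≠ 0 := fun h => hxI (Ideal.Quotient.eq_zero_iff_mem.1 h)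
  by_cases h : ∃ i, χ (e i) ≠ 0
  · obtain ⟨i, hi⟩ := h
    obtain ⟨U, hU⟩ := exists_ultrafilter he hc χ i
      ((IsIdempotentElem.iff_eq_zero_or_one.1 ((he i).map χ)).resolve_left hi)
    exact hχ ((map_eq_of_ultrafilter (χ : T →ₙ+* T ⧸ I) U hU H).2 U.empty_notMem)
  · push Not at h
    exact hχ (map_eq_zero_of_basic (χ : T →ₙ+* T ⧸ I) h H)

/-- Both x - xy and y - yx are values of expressions for S \ S = ∅, so x = xy = yx = y. -/
theorem unique_of_commRing {T : Type w} [CommRing T] {Z : ι → Set Ω} {e : ι → T}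
    (he : ∀ i, IsIdempotentElem (e i)) (hc : CoverCompatible Z e) {S : Set Ω} {x y : T}
    (hx : BoolRep Z e S x) (hy : BoolRep Z e S y) : x = y := by
  have h₁ := hx.sdiff hy
  have h₂ := hy.sdiff hx
  rw [sdiff_self] at h₁ h₂
  have h₁ := h₁.eq_zero_of_empty he hc
  have h₂ := h₂.eq_zero_of_empty he hc
  rw [sub_eq_zero.1 h₁, mul_comm, ← sub_eq_zero.1 h₂]

theorem unique_of_ring {T : Type w} [Ring T] {Z : ι → Set Ω} {e : ι → T}
    (he : ∀ i, IsIdempotentElem (e i)) (hcomm : ∀ i j, Commute (e i) (e j))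
    (hc : CoverCompatible Z e) {S : Set Ω} {x y : T}
    (hx : BoolRep Z e S x) (hy : BoolRep Z e S y) : x = y := by
  -- The subring generated by commuting elements is commutative and contains the value of every
  -- expression.
  let D := Subring.closure (Set.range e)
  have : IsMulCommutative D := Subring.isMulCommutative_closure (by
    rintro _ ⟨i, rfl⟩ _ ⟨j, rfl⟩
    exact hcomm i j)
  let _ : CommRing D := { D.toRing with mul_comm := this.is_comm.comm }
  let e' : ι → D := fun i => ⟨e i, Subring.subset_closure ⟨i, rfl⟩⟩
  let f : D →+* T := D.subtype
  have hf : Function.Injective f := Subtype.val_injective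
  obtain ⟨a, rfl, ha⟩ := exists_of_map (e := e') (f : D →ₙ+* T) hx
  obtain ⟨b, rfl, hb⟩ := exists_of_map (e := e') (f : D →ₙ+* T) hy
  congr 1
  refine unique_of_commRing (fun i => hf ?_) (fun l m hl h => hf ?_) ha hb
  · exact (map_mul f _ _).trans (he i)
  · have := hc l m hl h
    rw [map_mul, map_list_prod, map_list_prod, map_zero, List.map_map, List.map_map]
    refine Eq.trans ?_ this
    congr 3

end BoolRep

/-! ### The edge shift and its cylinders. -/

namespace Ultragraph

variable {V : Type v} {E : Type w} (G : Ultragraph V E)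

theorem mem_edgeShift {x : Stream' E} :
    x ∈ G.edgeShift ↔ ∀ i, G.source (x.get (i + 1)) ∈ G.range (x.get i) := by
  constructor
  · intro h i
    by_contra hi
    refine h [x.get i, x.get (i + 1)] ⟨_, _, rfl, hi⟩ i ?_
    simp [Stream'.take_succ, Stream'.tail_eq_drop]
  · rintro h _ ⟨e, f, rfl, hef⟩ i heq
    simp only [List.length_cons, List.length_nil, zero_add, Nat.reduceAdd, Stream'.take_succ,
      Stream'.take_zero, List.cons.injEq, and_true] at heq
    obtain ⟨rfl, rfl⟩ := heq
    refine hef ?_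
    have := h i
    simpa [Stream'.tail_eq_drop, Stream'.head_drop] using this

theorem cons_mem_edgeShift {e : E} {x : Stream' E} :
    Stream'.cons e x ∈ G.edgeShift ↔ G.source x.head ∈ G.range e ∧ x ∈ G.edgeShift := by
  rw [mem_edgeShift, mem_edgeShift]
  constructor
  · intro h
    exact ⟨h 0, fun i => h (i + 1)⟩
  · rintro ⟨h0, h⟩ (_ | i)
    · exact h0
    · exact h i

theorem mem_language_iff {w : List E} :
    w ∈ Subshift.language G.edgeShift ↔ ∃ x, w ++ₛ x ∈ G.edgeShift := by
  constructor
  · rintro ⟨x, hx, hw⟩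
    refine ⟨x.drop w.length, ?_⟩
    have := Stream'.append_take_drop w.length x
    rw [hw] at this
    rwa [this]
  · rintro ⟨x, hx⟩
    exact ⟨_, hx, by rw [Stream'.take_append_of_le_length _ _ _ le_rfl, List.take_length]⟩

/-- The cylinder of the points `βx` of the edge shift such that the source of `x` lies in `A`. -/
def cylinder : List E → Set V → Set (Stream' E)
  | [], A => {x | x ∈ G.edgeShift ∧ G.source x.head ∈ A}
  | e :: β, A => {x | x ∈ G.edgeShift ∧ x.head = e ∧ x.tail ∈ cylinder β A}

theorem mem_cylinder {β : List E} {A : Set V} {y : Stream' E} :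
    y ∈ G.cylinder β A ↔ y ∈ G.edgeShift ∧
      ∃ x, y = β ++ₛ x ∧ x ∈ G.edgeShift ∧ G.source x.head ∈ A := by
  induction β generalizing y with
  | nil =>
    constructor
    · rintro ⟨h, h'⟩
      exact ⟨h, y, rfl, h, h'⟩
    · rintro ⟨-, x, rfl, h⟩
      exact h
  | cons e β ih =>
    constructor
    · rintro ⟨h, rfl, h'⟩
      obtain ⟨_, x, hx, h''⟩ := ih.1 h'
      refine ⟨h, x, ?_, h''⟩
      rw [Stream'.cons_append_stream, ← hx, Stream'.eta]
    · rintro ⟨h, x, rfl, h'⟩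
      refine ⟨h, rfl, ih.2 ⟨?_, x, rfl, h'⟩⟩
      exact (G.cons_mem_edgeShift.1 h).2

/-- The range of the last letter of the word `a :: l`. -/
def lastRange (a : E) (l : List E) : Set V := G.range ((a :: l).getLast (by simp))

theorem lastRange_cons (a b : E) (l : List E) : G.lastRange a (b :: l) = G.lastRange b l := rfl

/-- Forbidden words have length two. The continuation `z` shows that the word itself is admissible,
so only its junction with `x` remains to be checked. -/
theorem append_mem_edgeShift {a : E} {l : List E} {z x : Stream' E}
    (h : (a :: l) ++ₛ z ∈ G.edgeShift) :
    (a :: l) ++ₛ x ∈ G.edgeShift ↔ x ∈ G.edgeShift ∧ G.source x.head ∈ G.lastRange a l := by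
  induction l generalizing a with
  | nil => exact G.cons_mem_edgeShift.trans and_comm
  | cons b l ih =>
    rw [Stream'.cons_append_stream, cons_mem_edgeShift] at h ⊢
    rw [ih h.2, lastRange_cons]
    exact and_iff_right h.1

theorem C_cons_eq_cylinder {a : E} {l : List E} (h : a :: l ∈ Subshift.language G.edgeShift)
    (β : List E) : Subshift.C G.edgeShift (a :: l) β = G.cylinder β (G.lastRange a l) := by
  obtain ⟨z, hz⟩ := G.mem_language_iff.1 h
  ext y
  rw [mem_cylinder]
  exact and_congr_right fun _ => exists_congr fun x => and_congr_right fun _ =>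
    G.append_mem_edgeShift hz

theorem C_nil_eq_cylinder (b : E) (m : List E) :
    Subshift.C G.edgeShift [] (b :: m) = G.cylinder (b :: m) (G.lastRange b m) := by
  ext y
  rw [mem_cylinder]
  refine and_congr_right fun h => exists_congr fun x => and_congr_right fun hy => ?_
  subst hy
  have := G.append_mem_edgeShift h (x := x)
  exact ⟨fun _ => this.1 h, fun h => h.1⟩

variable {G}

theorem exists_mem_edgeShift (hG : ∀ x, G.IsRegular x) (v : V) :
    ∃ x ∈ G.edgeShift, G.source x.head = v := by
  choose f hf using fun x => (hG x).1
  choose g hg using G.range_nonempty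
  -- A path is built greedily: `g e` is a vertex in the range of `e`, and `f` picks an edge that
  -- this vertex emits.
  refine ⟨Stream'.iterate (fun e => f (g e)) (f v), ?_, hf v⟩
  rw [mem_edgeShift]
  intro i
  rw [Stream'.get_succ_iterate']
  have := hf (g ((Stream'.iterate (fun e => f (g e)) (f v)).get i))
  rw [Set.mem_ofPred_eq] at this
  rw [this]
  exact hg _

theorem exists_cons_mem_edgeShift (hG : ∀ x, G.IsRegular x) (e : E) :
    ∃ x, Stream'.cons e x ∈ G.edgeShift := by
  obtain ⟨v, hv⟩ := G.range_nonempty e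
  obtain ⟨x, hx, rfl⟩ := exists_mem_edgeShift hG v
  exact ⟨x, G.cons_mem_edgeShift.2 ⟨hv, hx⟩⟩

theorem singleton_mem_language (hG : ∀ x, G.IsRegular x) (e : E) :
    [e] ∈ Subshift.language G.edgeShift :=
  G.mem_language_iff.2 (exists_cons_mem_edgeShift hG e)

theorem nil_mem_language (hG : ∀ x, G.IsRegular x) (e : E) :
    [] ∈ Subshift.language G.edgeShift :=
  G.mem_language_iff.2 ((exists_cons_mem_edgeShift hG e).imp fun _ h => (G.cons_mem_edgeShift.1 h).2)

variable (G)

theorem cylinder_range (hG : ∀ x, G.IsRegular x) (e : E) :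
    G.cylinder [] (G.range e) = Subshift.C G.edgeShift [e] [] :=
  (G.C_cons_eq_cylinder (singleton_mem_language hG e) []).symm

theorem mem_C_nil_singleton {e : E} {x : Stream' E} :
    x ∈ Subshift.C G.edgeShift [] [e] ↔ x ∈ G.edgeShift ∧ x.head = e := by
  constructor
  · rintro ⟨h, y, rfl, -⟩
    exact ⟨h, rfl⟩
  · rintro ⟨h, rfl⟩
    refine ⟨h, x.tail, (Stream'.eta x).symm, ?_⟩
    rw [← Stream'.eta x] at h
    exact (G.cons_mem_edgeShift.1 h).2

theorem cylinder_singleton (v : V) (h : {e | G.source e = v}.Finite) :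
    G.cylinder [] {v} = ⋃ e ∈ h.toFinset, Subshift.C G.edgeShift [] [e] := by
  ext x
  simp only [Set.mem_iUnion, mem_C_nil_singleton, Set.Finite.mem_toFinset, Set.mem_ofPred_eq]
  constructor
  · rintro ⟨h, h'⟩
    exact ⟨_, h', h, rfl⟩
  · rintro ⟨_, h', h, rfl⟩
    exact ⟨h, h'⟩

theorem cylinder_empty : G.cylinder [] ∅ = ∅ := by
  ext x
  simp [cylinder]

theorem cylinder_union (A B : Set V) :
    G.cylinder [] (A ∪ B) = G.cylinder [] A ∪ G.cylinder [] B := by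
  ext x
  simp [cylinder, and_or_left]

theorem cylinder_inter (A B : Set V) :
    G.cylinder [] (A ∩ B) = G.cylinder [] A ∩ G.cylinder [] B := by
  ext x
  simp only [cylinder, Set.mem_inter_iff, Set.mem_ofPred_eq]
  tauto

theorem inB_biUnion {A : Type*} {X : Set (Stream' A)} {κ : Type*} (t : Finset κ)
    (f : κ → Set (Stream' A)) (h : ∀ k ∈ t, Subshift.InB X (f k)) :
    Subshift.InB X (⋃ k ∈ t, f k) := by
  classical
  induction t using Finset.induction_on with
  | empty => simpa using Subshift.InB.empty
  | insert a t _ ih =>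
    rw [Finset.set_biUnion_insert]
    exact (h a (by simp)).union (ih fun k hk => h k (by simp [hk]))

/-- Regularity enters through the singletons: finitely many edges leave a vertex, so its cylinder is
a finite union of sets C(ω, e). -/
theorem inB_cylinder (hG : ∀ x, G.IsRegular x) {A : Set V} (hA : G.IsGenVertex A) :
    Subshift.InB G.edgeShift (G.cylinder [] A) := by
  induction hA with
  | singleton v =>
    rw [G.cylinder_singleton v (hG v).2]
    exact inB_biUnion _ _ fun e _ =>
      .basic _ _ (nil_mem_language hG e) (singleton_mem_language hG e) (by simp)
  | range e =>
    rw [G.cylinder_range hG]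
    exact .basic _ _ (singleton_mem_language hG e) (nil_mem_language hG e) (by simp)
  | empty =>
    rw [cylinder_empty]
    exact .empty
  | union _ _ h₁ h₂ =>
    rw [cylinder_union]
    exact h₁.union h₂
  | inter _ _ h₁ h₂ =>
    rw [cylinder_inter]
    exact h₁.inter h₂

end Ultragraph

/-! ### Leavitt families and the commuting idempotents s_β p_A s_β^*. -/

namespace Ultragraph

variable {V : Type v} {E : Type w} (G : Ultragraph V E)

/-- Elements of a ring that satisfy the defining relations of the Leavitt path algebra of `G`. -/
structure LeavittFamily (T : Type u) [NonUnitalRing T] where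
  p : ∀ S, G.IsGenVertex S → T
  s : E → T
  sStar : E → T
  p_empty : p ∅ .empty = 0
  p_mul_p : ∀ S S' hS hS', p S hS * p S' hS' = p (S ∩ S') (hS.inter hS')
  p_union : ∀ S S' hS hS', p (S ∪ S') (hS.union hS') =
    p S hS + p S' hS' - p (S ∩ S') (hS.inter hS')
  source_s : ∀ e, p {G.source e} (.singleton _) * s e = s e
  s_range : ∀ e, s e * p (G.range e) (.range e) = s e
  range_sStar : ∀ e, p (G.range e) (.range e) * sStar e = sStar e
  sStar_source : ∀ e, sStar e * p {G.source e} (.singleton _) = sStar e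
  sStar_s_same : ∀ e, sStar e * s e = p (G.range e) (.range e)
  sStar_s_ne : ∀ e f, e ≠ f → sStar e * s f = 0
  vertex : ∀ x (h : G.IsRegular x), p {x} (.singleton x) = ∑ e ∈ h.2.toFinset, s e * sStar e

namespace LeavittFamily

variable {G} {T : Type u} [NonUnitalRing T] (F : G.LeavittFamily T)

/-- The image of a Leavitt family under a homomorphism. -/
@[simps]
def map {T' : Type*} [NonUnitalRing T'] (f : T →ₙ+* T') : G.LeavittFamily T' where
  p S hS := f (F.p S hS)
  s e := f (F.s e)
  sStar e := f (F.sStar e)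
  p_empty := by rw [F.p_empty, map_zero]
  p_mul_p S S' hS hS' := by rw [← map_mul, F.p_mul_p]
  p_union S S' hS hS' := by rw [F.p_union, map_sub, map_add]
  source_s e := by rw [← map_mul, F.source_s]
  s_range e := by rw [← map_mul, F.s_range]
  range_sStar e := by rw [← map_mul, F.range_sStar]
  sStar_source e := by rw [← map_mul, F.sStar_source]
  sStar_s_same e := by rw [← map_mul, F.sStar_s_same]
  sStar_s_ne e f h := by rw [← map_mul, F.sStar_s_ne e f h, map_zero]
  vertex x h := by simp_rw [F.vertex x h, map_sum, map_mul]

theorem p_congr {S S' : Set V} (h : S = S') (hS : G.IsGenVertex S) (hS' : G.IsGenVertex S') :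
    F.p S hS = F.p S' hS' := by
  subst h
  rfl

theorem p_mul_s_of_mem {S : Set V} (hS : G.IsGenVertex S) {e : E} (h : G.source e ∈ S) :
    F.p S hS * F.s e = F.s e := by
  rw [← F.source_s e, ← mul_assoc, F.p_mul_p]
  congr 1
  exact F.p_congr (by simpa using h) _ _

theorem p_mul_s_of_notMem {S : Set V} (hS : G.IsGenVertex S) {e : E} (h : G.source e ∉ S) :
    F.p S hS * F.s e = 0 := by
  rw [← F.source_s e, ← mul_assoc, F.p_mul_p, F.p_congr (S' := ∅) (by simpa using h) _ .empty,
    F.p_empty, zero_mul]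

theorem sStar_mul_p_of_mem {S : Set V} (hS : G.IsGenVertex S) {e : E} (h : G.source e ∈ S) :
    F.sStar e * F.p S hS = F.sStar e := by
  rw [← F.sStar_source e, mul_assoc, F.p_mul_p]
  congr 1
  exact F.p_congr (by simpa using h) _ _

theorem sStar_mul_p_of_notMem {S : Set V} (hS : G.IsGenVertex S) {e : E} (h : G.source e ∉ S) :
    F.sStar e * F.p S hS = 0 := by
  rw [← F.sStar_source e, mul_assoc, F.p_mul_p, F.p_congr (S' := ∅) (by simpa using h) _ .empty,
    F.p_empty, mul_zero]

theorem p_comm {S S' : Set V} (hS : G.IsGenVertex S) (hS' : G.IsGenVertex S') :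
    F.p S hS * F.p S' hS' = F.p S' hS' * F.p S hS := by
  rw [F.p_mul_p, F.p_mul_p]
  exact F.p_congr (Set.inter_comm _ _) _ _

/-- The element `s_β p_A s_β^*`. -/
def corner : List E → {S // G.IsGenVertex S} → T
  | [], A => F.p A.1 A.2
  | e :: β, A => F.s e * corner β A * F.sStar e

theorem corner_map {T' : Type*} [NonUnitalRing T'] (f : T →ₙ+* T') (β : List E)
    (A : {S // G.IsGenVertex S}) : (F.map f).corner β A = f (F.corner β A) := by
  induction β with
  | nil => rfl
  | cons e β ih =>
    rw [corner, corner, ih, map_mul, map_mul]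
    rfl

/-- If β begins with e, then p_S either fixes both s_e and s_e^* or kills both, according to whether
s(e) ∈ S. -/
theorem p_mul_corner {S : Set V} (hS : G.IsGenVertex S) (β : List E)
    (A : {S // G.IsGenVertex S}) :
    F.p S hS * F.corner β A = F.corner β A * F.p S hS := by
  cases β with
  | nil => exact F.p_comm _ _
  | cons e β =>
    rw [corner, mul_assoc, mul_assoc, mul_assoc, ← mul_assoc]
    by_cases h : G.source e ∈ S
    · rw [F.p_mul_s_of_mem hS h, F.sStar_mul_p_of_mem hS h]
    · rw [F.p_mul_s_of_notMem hS h, F.sStar_mul_p_of_notMem hS h, zero_mul, mul_zero, mul_zero]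

/-- The inner s_e^* s_e is p_{r(e)}, which commutes past the remaining factor and is absorbed by the
last s_e^*. -/
theorem corner_mul_corner_cons_same (e : E) (β γ : List E) (A B : {S // G.IsGenVertex S}) :
    F.corner (e :: β) A * F.corner (e :: γ) B =
      F.s e * (F.corner β A * F.corner γ B) * F.sStar e := by
  calc
    _ = F.s e * F.corner β A * (F.sStar e * F.s e) * F.corner γ B * F.sStar e := by
      simp only [corner, mul_assoc]
    _ = F.s e * F.corner β A * (F.p _ (.range e) * F.corner γ B) * F.sStar e := by
      rw [F.sStar_s_same]
      simp only [mul_assoc]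
    _ = F.s e * (F.corner β A * F.corner γ B) * (F.p _ (.range e) * F.sStar e) := by
      rw [F.p_mul_corner]
      simp only [mul_assoc]
    _ = _ := by rw [F.range_sStar]

theorem corner_mul_corner_cons_ne {e f : E} (h : e ≠ f) (β γ : List E)
    (A B : {S // G.IsGenVertex S}) : F.corner (e :: β) A * F.corner (f :: γ) B = 0 := by
  calc
    _ = F.s e * F.corner β A * (F.sStar e * F.s f) * F.corner γ B * F.sStar f := by
      simp only [corner, mul_assoc]
    _ = 0 := by rw [F.sStar_s_ne e f h, mul_zero, zero_mul, zero_mul]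

theorem isIdempotentElem_corner (β : List E) (A : {S // G.IsGenVertex S}) :
    IsIdempotentElem (F.corner β A) := by
  induction β with
  | nil =>
    rw [IsIdempotentElem, corner, F.p_mul_p]
    exact F.p_congr (Set.inter_self _) _ _
  | cons e β ih => rw [IsIdempotentElem, corner_mul_corner_cons_same, ih, corner]

theorem commute_corner (β γ : List E) (A B : {S // G.IsGenVertex S}) :
    Commute (F.corner β A) (F.corner γ B) := by
  induction β generalizing γ with
  | nil => exact F.p_mul_corner _ _ _
  | cons e β ih =>
    cases γ with
    | nil => exact (F.p_mul_corner _ _ _).symm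
    | cons f γ =>
      by_cases h : e = f
      · subst h
        rw [Commute, SemiconjBy, corner_mul_corner_cons_same, corner_mul_corner_cons_same, ih]
      · rw [Commute, SemiconjBy, F.corner_mul_corner_cons_ne h,
          F.corner_mul_corner_cons_ne (Ne.symm h)]

open Classical in
/-- The cylinder of the points `x` such that `fx` lies in a given cylinder. -/
noncomputable def shiftIndex (f : E) :
    List E × {S // G.IsGenVertex S} → List E × {S // G.IsGenVertex S}
  | ([], A) => if G.source f ∈ A.1 then ([], ⟨_, .range f⟩) else ([], ⟨_, .empty⟩)
  | (g :: γ, A) => if g = f then (γ, A) else ([], ⟨_, .empty⟩)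

theorem length_shiftIndex_le {n : ℕ} (f : E) (i : List E × {S // G.IsGenVertex S})
    (h : i.1.length ≤ n + 1) : (shiftIndex f i).1.length ≤ n := by
  rcases i with ⟨_ | ⟨g, γ⟩, A⟩
  · rw [shiftIndex]
    split_ifs <;> simp
  · rw [shiftIndex]
    split_ifs
    · simpa using h
    · simp

theorem mem_cylinder_shiftIndex {f : E} {x : Stream' E} (hx : Stream'.cons f x ∈ G.edgeShift)
    (i : List E × {S // G.IsGenVertex S}) :
    Stream'.cons f x ∈ G.cylinder i.1 i.2 ↔
      x ∈ G.cylinder (shiftIndex f i).1 (shiftIndex f i).2 := by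
  have hx' := G.cons_mem_edgeShift.1 hx
  rcases i with ⟨_ | ⟨g, γ⟩, A⟩
  · rw [shiftIndex]
    split_ifs with h
    · exact iff_of_true ⟨hx, h⟩ ⟨hx'.2, hx'.1⟩
    · refine iff_of_false (fun H => h H.2) ?_
      rw [cylinder_empty]
      exact id
  · rw [shiftIndex]
    split_ifs with h
    · subst h
      exact ⟨fun H => H.2.2, fun H => ⟨hx, rfl, H⟩⟩
    · refine iff_of_false (fun H => h H.2.1.symm) ?_
      rw [cylinder_empty]
      exact id

/-- The algebraic counterpart of `mem_cylinder_shiftIndex`: moving an idempotent past s_f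
corresponds to taking the preimage of its cylinder under x ↦ fx. -/
theorem corner_mul_s (f : E) (i : List E × {S // G.IsGenVertex S}) :
    F.corner i.1 i.2 * F.s f = F.s f * F.corner (shiftIndex f i).1 (shiftIndex f i).2 := by
  rcases i with ⟨_ | ⟨g, γ⟩, A⟩
  · rw [shiftIndex]
    split_ifs with h
    · exact (F.p_mul_s_of_mem _ h).trans (F.s_range f).symm
    · refine (F.p_mul_s_of_notMem _ h).trans ?_
      rw [corner, F.p_empty, mul_zero]
  · rw [shiftIndex]
    split_ifs with h
    · subst h
      rw [corner, mul_assoc, F.sStar_s_same, mul_assoc, ← F.p_mul_corner, ← mul_assoc, F.s_range]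
    · change F.s g * F.corner γ A * F.sStar g * F.s f = F.s f * F.p ∅ .empty
      rw [mul_assoc, F.sStar_s_ne g f h, F.p_empty, mul_zero, mul_zero]

end LeavittFamily

end Ultragraph

/-! ### Products of commuting idempotents. -/

theorem List.prod_map_mul_eq {ι T : Type*} [Monoid T] (a : T) (e e' : ι → T) (l : List ι)
    (h : ∀ i, e i * a = a * e' i) : (l.map e).prod * a = a * (l.map e').prod := by
  induction l with
  | nil => simp
  | cons i l ih => rw [map_cons, map_cons, prod_cons, prod_cons, mul_assoc, ih, ← mul_assoc, h,
      mul_assoc]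

theorem List.commute_prod_map {ι T : Type*} [Monoid T] (a : T) (e : ι → T) (l : List ι)
    (h : ∀ i, Commute (e i) a) : Commute (l.map e).prod a :=
  List.prod_map_mul_eq a e e l h

theorem List.prod_map_mul_of_mem {ι T : Type*} [Monoid T] (e : ι → T)
    (he : ∀ i, IsIdempotentElem (e i)) (hc : ∀ i j, Commute (e i) (e j)) {l : List ι} {i : ι}
    (hi : i ∈ l) : (l.map e).prod * e i = (l.map e).prod := by
  induction l with
  | nil => simp at hi
  | cons j l ih =>
    rw [map_cons, prod_cons]
    rcases mem_cons.1 hi with rfl | hi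
    · rw [mul_assoc, (List.commute_prod_map (e i) e l fun j => hc j i).eq, ← mul_assoc, he i]
    · rw [mul_assoc, ih hi]

theorem List.prod_map_one_sub_mul_of_mem {ι T : Type*} [Ring T] (e : ι → T)
    (he : ∀ i, IsIdempotentElem (e i)) (hc : ∀ i j, Commute (e i) (e j)) {l : List ι} {i : ι}
    (hi : i ∈ l) : (l.map fun j => 1 - e j).prod * e i = 0 := by
  rw [← List.prod_map_mul_of_mem (fun j => 1 - e j) (fun i => (he i).one_sub)
    (fun i j => ((Commute.one_left _).sub_left ((Commute.one_right _).sub_right (hc i j)))) hi,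
    mul_assoc, sub_mul, one_mul, he i, sub_self, mul_zero]

/-! ### Vanishing of products that correspond to empty sets of points. -/

namespace Ultragraph.LeavittFamily

variable {V : Type v} {E : Type w} {G : Ultragraph V E}

section Ring

variable {T : Type u} [Ring T] (F : G.LeavittFamily T)

/-- The product of the idempotents indexed by `l` and the complements of those indexed by `m`. -/
def atom (l m : List (List E × {S // G.IsGenVertex S})) : T :=
  (l.map fun i => F.corner i.1 i.2).prod * (m.map fun j => 1 - F.corner j.1 j.2).prod

/-- The extra index r(f), harmless because s_f p_{r(f)} = s_f, keeps the positive list nonempty and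
forces fω to be admissible for every ω in the new intersection. -/
theorem atom_mul_s (f : E) (l m : List (List E × {S // G.IsGenVertex S})) :
    F.atom l m * F.s f =
      F.s f * F.atom (([], ⟨_, .range f⟩) :: l.map (shiftIndex f)) (m.map (shiftIndex f)) := by
  rw [atom, mul_assoc, List.prod_map_mul_eq (F.s f) _
    (fun j => 1 - F.corner (shiftIndex f j).1 (shiftIndex f j).2), ← mul_assoc,
    List.prod_map_mul_eq (F.s f) _ (fun j => F.corner (shiftIndex f j).1 (shiftIndex f j).2),
    atom, List.map_cons, List.prod_cons, ← mul_assoc, ← mul_assoc]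
  · rw [corner, F.s_range, List.map_map, List.map_map]
    rfl
  · exact F.corner_mul_s f
  · intro i
    rw [sub_mul, mul_sub, one_mul, mul_one, F.corner_mul_s]

theorem commute_atom (l m : List (List E × {S // G.IsGenVertex S}))
    (i : List E × {S // G.IsGenVertex S}) : Commute (F.atom l m) (F.corner i.1 i.2) :=
  (List.commute_prod_map _ _ _ fun _ => F.commute_corner _ _ _ _).mul_left
    (List.commute_prod_map _ _ _ fun _ => (Commute.one_left _).sub_left (F.commute_corner _ _ _ _))

theorem atom_mul_of_mem_left {l m : List (List E × {S // G.IsGenVertex S})}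
    {i : List E × {S // G.IsGenVertex S}} (hi : i ∈ l) :
    F.atom l m * F.corner i.1 i.2 = F.atom l m := by
  rw [(F.commute_atom l m i).eq, atom, ← mul_assoc]
  congr 1
  rw [← (List.commute_prod_map _ _ _ fun _ => F.commute_corner _ _ _ _).eq]
  exact List.prod_map_mul_of_mem (fun i => F.corner i.1 i.2)
    (fun _ => F.isIdempotentElem_corner _ _) (fun _ _ => F.commute_corner _ _ _ _) hi

theorem atom_mul_of_mem_right {l m : List (List E × {S // G.IsGenVertex S})}
    {i : List E × {S // G.IsGenVertex S}} (hi : i ∈ m) :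
    F.atom l m * F.corner i.1 i.2 = 0 := by
  rw [atom, mul_assoc, List.prod_map_one_sub_mul_of_mem (fun i => F.corner i.1 i.2)
    (fun _ => F.isIdempotentElem_corner _ _) (fun _ _ => F.commute_corner _ _ _ _) hi, mul_zero]

theorem exists_prod_eq_p (l : List (List E × {S // G.IsGenVertex S})) (hl : l ≠ [])
    (h : ∀ i ∈ l, i.1 = []) : ∃ A, ∃ hA : G.IsGenVertex A,
      (l.map fun i => F.corner i.1 i.2).prod = F.p A hA ∧ ∀ v ∈ A, ∀ i ∈ l, v ∈ i.2.1 := by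
  induction l with
  | nil => exact absurd rfl hl
  | cons i l ih =>
    obtain ⟨β, A⟩ := i
    obtain rfl : β = [] := h _ List.mem_cons_self
    rcases eq_or_ne l [] with rfl | hl'
    · exact ⟨A.1, A.2, by simp [corner], by simp⟩
    · obtain ⟨B, hB, hp, hv⟩ := ih hl' fun i hi => h i (List.mem_cons_of_mem _ hi)
      refine ⟨A.1 ∩ B, A.2.inter hB, ?_, ?_⟩
      · rw [List.map_cons, List.prod_cons, hp, ← F.p_mul_p]
        rfl
      · rintro v ⟨h1, h2⟩ i hi
        rcases List.mem_cons.1 hi with rfl | hi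
        · exact h1
        · exact hv v h2 i hi

/-- The generalised vertices whose projections x kills are closed under finite unions, so one of
them can serve all negative cylinders at once. -/
theorem exists_genVertex_of_forall (x : T) (m : List (List E × {S // G.IsGenVertex S}))
    (h : ∀ i ∈ m, ∃ A, ∃ hA : G.IsGenVertex A, x * F.p A hA = 0 ∧
      ∀ ω ∈ G.cylinder i.1 i.2, G.source ω.head ∈ A) :
    ∃ A, ∃ hA : G.IsGenVertex A, x * F.p A hA = 0 ∧
      ∀ i ∈ m, ∀ ω ∈ G.cylinder i.1 i.2, G.source ω.head ∈ A := by
  induction m with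
  | nil => exact ⟨∅, .empty, by rw [F.p_empty, mul_zero], by simp⟩
  | cons i m ih =>
    obtain ⟨A, hA, hxA, hA'⟩ := h i List.mem_cons_self
    obtain ⟨B, hB, hxB, hB'⟩ := ih fun i hi => h i (List.mem_cons_of_mem _ hi)
    refine ⟨A ∪ B, hA.union hB, ?_, ?_⟩
    · rw [F.p_union _ _ hA hB, mul_sub, mul_add, hxA, hxB, ← F.p_mul_p _ _ hA hB, ← mul_assoc, hxA, zero_mul, add_zero,
        sub_zero]
    · intro j hj ω hω
      rcases List.mem_cons.1 hj with rfl | hj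
      · exact Or.inl (hA' ω hω)
      · exact Or.inr (hB' j hj ω hω)

variable (hG : ∀ x, G.IsRegular x)
include hG

/-- The inductive step and the base case in one: the hypothesis on s_f is asked for only if some
word is nonempty, so it is vacuous when all words are empty. -/
theorem atom_eq_zero_of_atom_mul_s {l m : List (List E × {S // G.IsGenVertex S})} (hl : l ≠ [])
    (hlm : ∀ ω, (∀ i ∈ l, ω ∈ G.cylinder i.1 i.2) → ∃ j ∈ m, ω ∈ G.cylinder j.1 j.2)
    (h : ∀ i ∈ l ++ m, i.1 ≠ [] → ∀ f, F.atom l m * F.s f = 0) : F.atom l m = 0 := by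
  by_cases hnil : ∀ i ∈ l, i.1 = []
  · obtain ⟨A, hA, hp, hAl⟩ := F.exists_prod_eq_p l hl hnil
    obtain ⟨B, hB, hxB, hBm⟩ := F.exists_genVertex_of_forall (F.atom l m) m (by
      rintro ⟨_ | ⟨f, β⟩, A⟩ hj
      · exact ⟨A.1, A.2, F.atom_mul_of_mem_right hj, fun ω hω => hω.2⟩
      · refine ⟨{G.source f}, .singleton _, ?_, fun ω hω => congrArg G.source hω.2.1⟩
        -- By the vertex relation, an element that kills every s_e kills every vertex projection.
        rw [F.vertex _ (hG _), Finset.mul_sum]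
        refine Finset.sum_eq_zero fun e _ => ?_
        rw [← mul_assoc, h _ (List.mem_append_right _ hj) (by simp) e, zero_mul])
    -- Every vertex of A is the source of a point of the shift; that point lies in all positive
    -- cylinders, hence in a negative one, whose points have their sources in B.
    have hAB : A ⊆ B := by
      intro v hv
      obtain ⟨x, hx, rfl⟩ := exists_mem_edgeShift hG v
      obtain ⟨j, hj, hxj⟩ := hlm x fun i hi => by
        have := hAl _ hv i hi
        have h' := hnil i hi
        obtain ⟨β, A⟩ := i
        subst h'
        exact ⟨hx, this⟩
      exact hBm j hj x hxj
    have hpB : F.p B hB * F.p A hA = F.p A hA := by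
      rw [F.p_mul_p]
      exact F.p_congr (Set.inter_eq_right.2 hAB) _ _
    -- The product begins with p_A, so p_B fixes it from the left, while p_B kills it from the
    -- right; as the two commute, it vanishes.
    have hcomm := (F.commute_atom l m ([], ⟨B, hB⟩)).eq
    rw [corner] at hcomm
    rw [hxB, atom, hp, ← mul_assoc, hpB, ← hp] at hcomm
    exact hcomm.symm
  · push Not at hnil
    obtain ⟨⟨_ | ⟨f, β⟩, A⟩, hi, hi'⟩ := hnil
    · exact absurd rfl hi'
    · rw [← F.atom_mul_of_mem_left hi, corner, ← mul_assoc, ← mul_assoc,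
        h _ (List.mem_append_left _ hi) hi' f, zero_mul, zero_mul]

theorem coverCompatible : CoverCompatible (fun i : List E × {S // G.IsGenVertex S} =>
    G.cylinder i.1 i.2) (fun i => F.corner i.1 i.2) := by
  suffices H : ∀ n, ∀ l m : List (List E × {S // G.IsGenVertex S}),
      (∀ i ∈ l ++ m, i.1.length ≤ n) → l ≠ [] →
      (∀ ω, (∀ i ∈ l, ω ∈ G.cylinder i.1 i.2) → ∃ j ∈ m, ω ∈ G.cylinder j.1 j.2) →
      F.atom l m = 0 by
    intro l m
    -- The sum of all word lengths is a crude common bound for them.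
    refine H (((l ++ m).map fun i => i.1.length).sum) l m fun i hi => ?_
    exact List.le_sum_of_mem (List.mem_map_of_mem hi)
  intro n
  induction n with
  | zero =>
    intro l m hn hl hlm
    refine F.atom_eq_zero_of_atom_mul_s hG hl hlm fun i hi hne => ?_
    exact absurd (List.length_eq_zero_iff.1 (Nat.le_zero.1 (hn i hi))) hne
  | succ n ih =>
    intro l m hn hl hlm
    refine F.atom_eq_zero_of_atom_mul_s hG hl hlm fun _ _ _ f => ?_
    rw [atom_mul_s, ih, mul_zero]
    · intro i hi
      rw [List.cons_append, ← List.map_append, List.mem_cons, List.mem_map] at hi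
      rcases hi with rfl | ⟨i, hi, rfl⟩
      · simp
      · exact length_shiftIndex_le f i (hn i hi)
    · simp
    · intro ω hω
      obtain ⟨h1, h2⟩ := hω _ List.mem_cons_self
      have hfω := G.cons_mem_edgeShift.2 ⟨h2, h1⟩
      obtain ⟨j, hj, hj'⟩ := hlm (Stream'.cons f ω) fun i hi =>
        (mem_cylinder_shiftIndex hfω i).2
          (hω _ (List.mem_cons_of_mem _ (List.mem_map_of_mem hi)))
      exact ⟨_, List.mem_map_of_mem hj, (mem_cylinder_shiftIndex hfω j).1 hj'⟩

end Ring

/-- The complements 1 - e_j need a unit, so uniqueness is proved in a unital ring and pulled back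
along an embedding; the unitization over ℤ is one that always exists. -/
theorem boolRep_unique_of_injective {T : Type*} [NonUnitalRing T] {T' : Type*} [Ring T']
    (F : G.LeavittFamily T) (hG : ∀ x, G.IsRegular x) (f : T →ₙ+* T')
    (hf : Function.Injective f) {S : Set (Stream' E)} {x y : T}
    (hx : BoolRep (fun i : List E × {S // G.IsGenVertex S} => G.cylinder i.1 i.2)
      (fun i => F.corner i.1 i.2) S x)
    (hy : BoolRep (fun i : List E × {S // G.IsGenVertex S} => G.cylinder i.1 i.2)
      (fun i => F.corner i.1 i.2) S y) : x = y := by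
  have hx := hx.map f
  have hy := hy.map f
  simp only [← F.corner_map] at hx hy
  exact hf (BoolRep.unique_of_ring (fun _ => (F.map f).isIdempotentElem_corner _ _)
    (fun _ _ => (F.map f).commute_corner _ _ _ _) ((F.map f).coverCompatible hG) hx hy)

/-- The element representing a set of points of the edge shift is unique. -/
theorem boolRep_unique {T : Type u} [NonUnitalRing T] (F : G.LeavittFamily T)
    (hG : ∀ x, G.IsRegular x) {S : Set (Stream' E)} {x y : T}
    (hx : BoolRep (fun i : List E × {S // G.IsGenVertex S} => G.cylinder i.1 i.2)
      (fun i => F.corner i.1 i.2) S x)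
    (hy : BoolRep (fun i : List E × {S // G.IsGenVertex S} => G.cylinder i.1 i.2)
      (fun i => F.corner i.1 i.2) S y) : x = y :=
  F.boolRep_unique_of_injective (T' := Unitization ℤ T) hG
    (Unitization.inrNonUnitalAlgHom ℤ T : T →ₙ+* Unitization ℤ T) Unitization.inr_injective hx hy

end Ultragraph.LeavittFamily

/-! ### Words in a Leavitt family and the homomorphism out of the subshift algebra. -/

namespace Subshift

variable {A : Type v}

theorem map_wordProd {M N H : Type*} [Mul M] [Mul N] [FunLike H M N] [MulHomClass H M N] (φ : H)
    (f : A → M) (a : A) (l : List A) : φ (wordProd f a l) = wordProd (fun b => φ (f b)) a l := by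
  induction l generalizing a with
  | nil => rfl
  | cons b l ih => rw [wordProd, wordProd, map_mul, ih]

theorem map_revWordProd {M N H : Type*} [Mul M] [Mul N] [FunLike H M N] [MulHomClass H M N]
    (φ : H) (f : A → M) (a : A) (l : List A) :
    φ (revWordProd f a l) = revWordProd (fun b => φ (f b)) a l := by
  induction l generalizing a with
  | nil => rfl
  | cons b l ih => rw [revWordProd, revWordProd, map_mul, ih]

end Subshift

namespace Ultragraph

open Subshift

variable {V : Type v} {E : Type w} {G : Ultragraph V E}

theorem isGenVertex_lastRange (a : E) (l : List E) : G.IsGenVertex (G.lastRange a l) := .range _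

namespace LeavittFamily

variable {T : Type u} [NonUnitalRing T] (F : G.LeavittFamily T)

theorem corner_cons (b : E) (m : List E) (A : {S // G.IsGenVertex S}) :
    F.corner (b :: m) A = wordProd F.s b m * F.p A.1 A.2 * revWordProd F.sStar b m := by
  induction m generalizing b with
  | nil => rfl
  | cons c m ih =>
    rw [corner, ih, wordProd, revWordProd]
    simp only [mul_assoc]

theorem wordProd_mul_p (a : E) (l : List E) :
    wordProd F.s a l * F.p (G.lastRange a l) (isGenVertex_lastRange a l) = wordProd F.s a l := by
  induction l generalizing a with
  | nil => exact F.s_range a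
  | cons b l ih =>
    rw [wordProd, mul_assoc]
    exact congrArg _ (ih b)

theorem p_mul_wordProd {S : Set V} (hS : G.IsGenVertex S) {b : E} (h : G.source b ∈ S)
    (m : List E) : F.p S hS * wordProd F.s b m = wordProd F.s b m := by
  cases m with
  | nil => exact F.p_mul_s_of_mem hS h
  | cons c m => rw [wordProd, ← mul_assoc, F.p_mul_s_of_mem hS h]

/-- The product collapses from the inside: s_a^* s_a = p_{r(a)} is absorbed by the next letter b,
since admissibility of the word gives s(b) ∈ r(a). -/
theorem revWordProd_mul_wordProd {a : E} {l : List E} (h : a :: l ∈ language G.edgeShift) :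
    revWordProd F.sStar a l * wordProd F.s a l =
      F.p (G.lastRange a l) (isGenVertex_lastRange a l) := by
  obtain ⟨x, hx⟩ := G.mem_language_iff.1 h
  clear h
  induction l generalizing a with
  | nil => exact F.sStar_s_same a
  | cons b l ih =>
    obtain ⟨h, h'⟩ := G.cons_mem_edgeShift.1 hx
    rw [revWordProd, wordProd, mul_assoc, ← mul_assoc (F.sStar a), F.sStar_s_same,
      F.p_mul_wordProd (b := b) _ h]
    exact ih h'

/-- The element of a Leavitt family that corresponds to the projection of `C(α, β)`. -/
def projC : List E → List E → T
  | a :: l, β => F.corner β ⟨_, isGenVertex_lastRange a l⟩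
  | [], b :: m => F.corner (b :: m) ⟨_, isGenVertex_lastRange b m⟩
  | [], [] => 0

variable (G) in
/-- Pairs of words that are not both empty in the language of the edge shift. -/
abbrev WordPair := {q : List E × List E // q.1 ∈ language G.edgeShift ∧
  q.2 ∈ language G.edgeShift ∧ ¬(q.1 = [] ∧ q.2 = [])}

/-- `x` is obtained from the elements corresponding to the sets `C(α, β)` like `S` is obtained from
these sets. -/
def Represents (S : Set (Stream' E)) (x : T) : Prop :=
  BoolRep (fun q : WordPair G => C G.edgeShift q.1.1 q.1.2)
    (fun q => F.projC q.1.1 q.1.2) S x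

/-- Expressions in the sets C(α, β) are what the subshift algebra can interpret; expressions in
cylinders, which include every p_A, are what the uniqueness theorem handles. -/
theorem Represents.boolRep {S : Set (Stream' E)} {x : T} (h : F.Represents S x) :
    BoolRep (fun i : List E × {S // G.IsGenVertex S} => G.cylinder i.1 i.2)
      (fun i => F.corner i.1 i.2) S x := by
  refine BoolRep.of_basic ?_ h
  rintro ⟨⟨_ | ⟨a, l⟩, _ | ⟨b, m⟩⟩, hα, hβ, hne⟩
  · exact absurd ⟨rfl, rfl⟩ hne
  · simp only [C_nil_eq_cylinder]
    exact .basic (Z := fun i : List E × {S // G.IsGenVertex S} => G.cylinder i.1 i.2)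
      (e := fun i => F.corner i.1 i.2) (b :: m, ⟨_, isGenVertex_lastRange b m⟩)
  all_goals
    simp only [G.C_cons_eq_cylinder hα]
    exact .basic (Z := fun i : List E × {S // G.IsGenVertex S} => G.cylinder i.1 i.2)
      (e := fun i => F.corner i.1 i.2) (_, ⟨_, isGenVertex_lastRange a l⟩)

theorem represents_C {α β : List E} (hα : α ∈ language G.edgeShift)
    (hβ : β ∈ language G.edgeShift) (h : ¬(α = [] ∧ β = [])) :
    F.Represents (C G.edgeShift α β) (F.projC α β) :=
  .basic (Z := fun q : WordPair G => C G.edgeShift q.1.1 q.1.2)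
    (e := fun q => F.projC q.1.1 q.1.2) ⟨(α, β), hα, hβ, h⟩

theorem exists_represents {S : Set (Stream' E)} (h : InB G.edgeShift S) :
    ∃ x, F.Represents S x := by
  induction h with
  | basic α β hα hβ h => exact ⟨_, F.represents_C hα hβ h⟩
  | empty => exact ⟨_, .empty⟩
  | union _ _ h₁ h₂ => exact ⟨_, .union h₁.choose_spec h₂.choose_spec⟩
  | inter _ _ h₁ h₂ => exact ⟨_, .inter h₁.choose_spec h₂.choose_spec⟩
  | sdiff _ _ h₁ h₂ => exact ⟨_, .sdiff h₁.choose_spec h₂.choose_spec⟩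

/-- The element representing a member of the Boolean algebra of the edge shift. -/
noncomputable def proj {S : Set (Stream' E)} (h : InB G.edgeShift S) : T :=
  (F.exists_represents h).choose

theorem represents_proj {S : Set (Stream' E)} (h : InB G.edgeShift S) :
    F.Represents S (F.proj h) :=
  (F.exists_represents h).choose_spec

variable (hG : ∀ x, G.IsRegular x)
include hG

theorem Represents.eq_proj {S : Set (Stream' E)} (h : InB G.edgeShift S) {x : T}
    (hx : F.Represents S x) : F.proj h = x :=
  F.boolRep_unique hG (Represents.boolRep F (F.represents_proj h)) hx.boolRep

theorem proj_C {α β : List E} (hα : α ∈ language G.edgeShift) (hβ : β ∈ language G.edgeShift)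
    (h : ¬(α = [] ∧ β = [])) : F.proj (.basic α β hα hβ h) = F.projC α β :=
  Represents.eq_proj F hG _ (F.represents_C hα hβ h)

/-- The chosen element and p_A arise from different expressions for the same set, so uniqueness
identifies them. -/
theorem proj_cylinder {A : Set V} (hA : G.IsGenVertex A) :
    F.proj (G.inB_cylinder hG hA) = F.p A hA :=
  F.boolRep_unique hG (Represents.boolRep F (F.represents_proj _))
    (.basic (Z := fun i : List E × {S // G.IsGenVertex S} => G.cylinder i.1 i.2)
      (e := fun i => F.corner i.1 i.2) ([], ⟨A, hA⟩))

variable (R : Type*) [CommRing R] [Module R T] [IsScalarTower R T T] [SMulCommClass R T T]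

omit hG in
/-- The images of the generators of the subshift algebra of the edge shift. -/
noncomputable def subshiftGen : Subshift.Gen G.edgeShift → T
  | .proj _ hS => F.proj hS
  | .s a => F.s a
  | .sStar a => F.sStar a

/-- The homomorphism from the subshift algebra of the edge shift given by a Leavitt family. -/
noncomputable def subshiftHom : Subshift.algebra R G.edgeShift →ₙₐ[R] T :=
  PresentedAlg.lift (FreeNonUnitalAlg.lift F.subshiftGen) (by
    have hp : ∀ S (hS : InB G.edgeShift S),
      FreeNonUnitalAlg.lift F.subshiftGen (Subshift.p R G.edgeShift S hS) = F.proj hS :=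
      fun S hS => FreeNonUnitalAlg.lift_gen _ _
    have hs : ∀ a,
      FreeNonUnitalAlg.lift F.subshiftGen (Subshift.s R G.edgeShift a) = F.s a :=
      fun a => FreeNonUnitalAlg.lift_gen _ _
    have ht : ∀ a,
      FreeNonUnitalAlg.lift F.subshiftGen (Subshift.sStar R G.edgeShift a) = F.sStar a :=
      fun a => FreeNonUnitalAlg.lift_gen _ _
    rintro _ _ (⟨S, S', hS, hS'⟩ | ⟨S, S', hS, hS'⟩ | _ | a | a | ⟨a, l, b, m, hα, hβ⟩ |
      ⟨a, l, hα, hω⟩ | ⟨b, m, hβ, hω⟩)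
    · rw [map_mul, hp, hp, hp]
      -- The Boolean relations hold by uniqueness: the product of the chosen elements also
      -- represents the intersection.
      exact Represents.eq_proj F hG _ (.inter (F.represents_proj _) (F.represents_proj _))
    · have : F.proj (hS.inter hS') = F.proj hS * F.proj hS' :=
        Represents.eq_proj F hG _ (.inter (F.represents_proj _) (F.represents_proj _))
      rw [map_sub, map_add, hp, hp, hp, hp, this]
      exact Represents.eq_proj F hG _ (.union (F.represents_proj _) (F.represents_proj _))
    · rw [hp, map_zero]
      exact Represents.eq_proj F hG _ .empty
    · rw [map_mul, map_mul, hs, ht, mul_assoc, F.sStar_s_same, F.s_range]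
    · rw [map_mul, map_mul, hs, ht, F.sStar_s_same, F.range_sStar]
    · simp only [sWord, sWordStar, map_mul, map_wordProd, map_revWordProd, hs, ht, hp]
      rw [F.proj_C hG hα hβ (by simp), projC, corner_cons, mul_assoc (wordProd _ _ _),
        F.revWordProd_mul_wordProd hα]
    · simp only [sWord, sWordStar, map_mul, map_wordProd, map_revWordProd, hs, ht, hp]
      rw [F.proj_C hG hα hω (by simp), projC, corner, F.revWordProd_mul_wordProd hα]
    · simp only [sWord, sWordStar, map_mul, map_wordProd, map_revWordProd, hs, ht, hp]
      rw [F.proj_C hG hω hβ (by simp), projC, corner_cons, F.wordProd_mul_p])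

@[simp]
theorem subshiftHom_gen (x : Subshift.Gen G.edgeShift) :
    F.subshiftHom hG R (PresentedAlg.mk _ (FreeNonUnitalAlg.gen R x)) = F.subshiftGen x := by
  rw [subshiftHom, PresentedAlg.lift_mk, FreeNonUnitalAlg.lift_gen]

omit hG

/-- The images of the generators of the Leavitt path algebra. -/
def leavittGen : G.Gen → T
  | .proj S hS => F.p S hS
  | .s e => F.s e
  | .sStar e => F.sStar e

/-- The homomorphism from the Leavitt path algebra given by a Leavitt family. -/
noncomputable def leavittHom : G.leavittPathAlgebra R →ₙₐ[R] T :=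
  PresentedAlg.lift (FreeNonUnitalAlg.lift F.leavittGen) (by
    have hp : ∀ S hS, FreeNonUnitalAlg.lift F.leavittGen (G.p R S hS) = F.p S hS :=
      fun S hS => FreeNonUnitalAlg.lift_gen _ _
    have hs : ∀ e, FreeNonUnitalAlg.lift F.leavittGen (G.s R e) = F.s e :=
      fun a => FreeNonUnitalAlg.lift_gen _ _
    have ht : ∀ e, FreeNonUnitalAlg.lift F.leavittGen (G.sStar R e) = F.sStar e :=
      fun a => FreeNonUnitalAlg.lift_gen _ _
    rintro _ _ (_ | ⟨S, S', hS, hS'⟩ | ⟨S, S', hS, hS'⟩ | e | e | e | e | e | ⟨e, f, h⟩ | ⟨x, h⟩)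
    · rw [hp, map_zero, F.p_empty]
    · rw [map_mul, hp, hp, hp, F.p_mul_p]
    · rw [map_sub, map_add, hp, hp, hp, hp, F.p_union]
    · rw [map_mul, hp, hs, F.source_s]
    · rw [map_mul, hp, hs, F.s_range]
    · rw [map_mul, hp, ht, F.range_sStar]
    · rw [map_mul, hp, ht, F.sStar_source]
    · rw [map_mul, hp, ht, hs, F.sStar_s_same]
    · rw [map_mul, ht, hs, map_zero, F.sStar_s_ne e f h]
    · simp only [map_sum, map_mul, hp, hs, ht]
      exact F.vertex x h)

@[simp]
theorem leavittHom_gen (x : G.Gen) :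
    F.leavittHom R (PresentedAlg.mk _ (FreeNonUnitalAlg.gen R x)) = F.leavittGen x := by
  rw [leavittHom, PresentedAlg.lift_mk, FreeNonUnitalAlg.lift_gen]

end LeavittFamily

variable (G) in
/-- The generators of the Leavitt path algebra. -/
noncomputable def leavittFamily (R : Type u) [CommRing R] :
    G.LeavittFamily (G.leavittPathAlgebra R) where
  p S hS := PresentedAlg.mk _ (G.p R S hS)
  s e := PresentedAlg.mk _ (G.s R e)
  sStar e := PresentedAlg.mk _ (G.sStar R e)
  p_empty := PresentedAlg.mk_eq_of_rel .proj_empty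
  p_mul_p S S' hS hS' := PresentedAlg.mk_eq_of_rel (.proj_inter S S' hS hS')
  p_union S S' hS hS' := by
    refine (PresentedAlg.mk_eq_of_rel (.proj_union S S' hS hS')).trans ?_
    simp only [← PresentedAlg.mkHom_apply, map_sub, map_add]
  source_s e := PresentedAlg.mk_eq_of_rel (.source_s e)
  s_range e := PresentedAlg.mk_eq_of_rel (.s_range e)
  range_sStar e := PresentedAlg.mk_eq_of_rel (.range_sStar e)
  sStar_source e := PresentedAlg.mk_eq_of_rel (.sStar_source e)
  sStar_s_same e := PresentedAlg.mk_eq_of_rel (.sStar_s_same e)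
  sStar_s_ne e f h := PresentedAlg.mk_eq_of_rel (.sStar_s_ne e f h)
  vertex x h := by
    refine (PresentedAlg.mk_eq_of_rel (.vertex x h)).trans ?_
    simp only [← PresentedAlg.mkHom_apply, map_sum, map_mul]

end Ultragraph

/-! ### Relations in the subshift algebra. -/

namespace Subshift

variable (R : Type u) [CommRing R] {A : Type v} (X : Set (Stream' A))

/-- The projection `p_S` in the subshift algebra. -/
noncomputable def proj (S : Set (Stream' A)) (hS : InB X S) : algebra R X :=
  PresentedAlg.mk _ (p R X S hS)

/-- The generator `s_a` of the subshift algebra. -/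
noncomputable def letter (a : A) : algebra R X := PresentedAlg.mk _ (s R X a)

/-- The generator `s_a^*` of the subshift algebra. -/
noncomputable def letterStar (a : A) : algebra R X := PresentedAlg.mk _ (sStar R X a)

variable {X}

theorem proj_congr {S S' : Set (Stream' A)} (h : S = S') (hS : InB X S) (hS' : InB X S') :
    proj R X S hS = proj R X S' hS' := by
  subst h
  rfl

theorem proj_empty : proj R X ∅ .empty = 0 := PresentedAlg.mk_eq_of_rel .proj_empty

theorem proj_mul_proj {S S' : Set (Stream' A)} (hS : InB X S) (hS' : InB X S') :
    proj R X S hS * proj R X S' hS' = proj R X (S ∩ S') (hS.inter hS') :=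
  (PresentedAlg.mk_eq_of_rel (.proj_inter S S' hS hS')).symm

theorem proj_union {S S' : Set (Stream' A)} (hS : InB X S) (hS' : InB X S') :
    proj R X (S ∪ S') (hS.union hS') =
      proj R X S hS + proj R X S' hS' - proj R X (S ∩ S') (hS.inter hS') := by
  refine (PresentedAlg.mk_eq_of_rel (.proj_union S S' hS hS')).trans ?_
  simp only [← PresentedAlg.mkHom_apply, map_sub, map_add, proj]

/-- Relative complements do not occur in the defining relations; the formula follows from the union
relation for the disjoint decomposition of S into S \ S' and S ∩ S'. -/
theorem proj_sdiff {S S' : Set (Stream' A)} (hS : InB X S) (hS' : InB X S') :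
    proj R X (S \ S') (hS.sdiff hS') = proj R X S hS - proj R X S hS * proj R X S' hS' := by
  have h := proj_union R (hS.sdiff hS') (hS.inter hS')
  rw [proj_congr R (Set.sdiff_union_inter S S') _ hS,
    proj_congr R (S' := ∅) (S := (S \ S') ∩ (S ∩ S')) (by ext; simp; tauto) _ .empty,
    proj_empty, sub_zero] at h
  rw [proj_mul_proj, h, add_sub_cancel_right]

theorem letter_mul_letterStar_mul_letter (a : A) :
    letter R X a * letterStar R X a * letter R X a = letter R X a :=
  PresentedAlg.mk_eq_of_rel (.s_sStar_s a)

theorem letterStar_mul_letter_mul_letterStar (a : A) :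
    letterStar R X a * letter R X a * letterStar R X a = letterStar R X a :=
  PresentedAlg.mk_eq_of_rel (.sStar_s_sStar a)

theorem mk_sWord (a : A) (l : List A) :
    PresentedAlg.mk (Rel R X) (sWord R X a l) = wordProd (letter R X) a l :=
  map_wordProd (PresentedAlg.mkHom (Rel R X)) _ _ _

theorem mk_sWordStar (a : A) (l : List A) :
    PresentedAlg.mk (Rel R X) (sWordStar R X a l) = revWordProd (letterStar R X) a l :=
  map_revWordProd (PresentedAlg.mkHom (Rel R X)) _ _ _

theorem wordProd_word_word {a : A} {l : List A} {b : A} {m : List A}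
    (hα : a :: l ∈ language X) (hβ : b :: m ∈ language X) :
    wordProd (letter R X) b m * revWordProd (letterStar R X) a l * wordProd (letter R X) a l *
      revWordProd (letterStar R X) b m =
      proj R X (C X (a :: l) (b :: m)) (.basic _ _ hα hβ (by simp)) := by
  have := PresentedAlg.mk_eq_of_rel (Rel.word_word (R := R) a l b m hα hβ)
  simp only [PresentedAlg.mk_mul, mk_sWord, mk_sWordStar] at this
  exact this

theorem wordProd_word_empty {a : A} {l : List A} (hα : a :: l ∈ language X)
    (hω : [] ∈ language X) :
    revWordProd (letterStar R X) a l * wordProd (letter R X) a l =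
      proj R X (C X (a :: l) []) (.basic _ _ hα hω (by simp)) := by
  have := PresentedAlg.mk_eq_of_rel (Rel.word_empty (R := R) a l hα hω)
  simp only [PresentedAlg.mk_mul, mk_sWord, mk_sWordStar] at this
  exact this

theorem wordProd_empty_word {b : A} {m : List A} (hβ : b :: m ∈ language X)
    (hω : [] ∈ language X) :
    wordProd (letter R X) b m * revWordProd (letterStar R X) b m =
      proj R X (C X [] (b :: m)) (.basic _ _ hω hβ (by simp)) := by
  have := PresentedAlg.mk_eq_of_rel (Rel.empty_word (R := R) b m hβ hω)
  simp only [PresentedAlg.mk_mul, mk_sWord, mk_sWordStar] at this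
  exact this

theorem proj_biUnion {κ : Type*} (t : Finset κ) (f : κ → Set (Stream' A))
    (hf : ∀ k, InB X (f k)) (hd : ∀ i j, i ≠ j → f i ∩ f j = ∅)
    (h : InB X (⋃ k ∈ t, f k)) :
    proj R X (⋃ k ∈ t, f k) h = ∑ k ∈ t, proj R X (f k) (hf k) := by
  classical
  induction t using Finset.induction_on with
  | empty =>
    rw [Finset.sum_empty, ← proj_empty R]
    exact proj_congr R (by simp) _ _
  | insert a t ha ih =>
    have ht : InB X (⋃ k ∈ t, f k) := Ultragraph.inB_biUnion t f fun k _ => hf k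
    have hemp : f a ∩ ⋃ k ∈ t, f k = ∅ := by
      simp only [Set.inter_iUnion, Set.iUnion_eq_empty]
      exact fun k hk => hd a k fun h => ha (h ▸ hk)
    rw [Finset.sum_insert ha, ← ih ht, proj_congr R (Finset.set_biUnion_insert a t f) h
      ((hf a).union ht), proj_union, proj_congr R hemp _ .empty, proj_empty, sub_zero]

end Subshift

/-! ### The Leavitt family inside the subshift algebra. -/

namespace Ultragraph

open Subshift

variable {V : Type v} {E : Type w} (G : Ultragraph V E) (R : Type u) [CommRing R]
  (hG : ∀ x, G.IsRegular x)

theorem inB_C_nil_singleton (hG : ∀ x, G.IsRegular x) (e : E) :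
    InB G.edgeShift (C G.edgeShift [] [e]) :=
  .basic _ _ (nil_mem_language hG e) (singleton_mem_language hG e) (by simp)

include hG

theorem letterStar_mul_letter (e : E) :
    letterStar R G.edgeShift e * letter R G.edgeShift e =
      Subshift.proj R G.edgeShift _ (G.inB_cylinder hG (.range e)) :=
  (wordProd_word_empty R (singleton_mem_language hG e) (nil_mem_language hG e)).trans
    (proj_congr R (G.cylinder_range hG e).symm _ _)

theorem letter_mul_letterStar (e : E) :
    letter R G.edgeShift e * letterStar R G.edgeShift e =
      Subshift.proj R G.edgeShift _ (G.inB_C_nil_singleton hG e) :=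
  wordProd_empty_word R (singleton_mem_language hG e) (nil_mem_language hG e)

omit hG in
theorem C_nil_singleton_inter_eq_empty {e f : E} (h : e ≠ f) :
    C G.edgeShift [] [e] ∩ C G.edgeShift [] [f] = ∅ := by
  rw [Set.eq_empty_iff_forall_notMem]
  rintro x ⟨hx, hx'⟩
  exact h ((G.mem_C_nil_singleton.1 hx).2.symm.trans (G.mem_C_nil_singleton.1 hx').2)

omit hG in
theorem cylinder_source_inter_C (e : E) :
    G.cylinder [] {G.source e} ∩ C G.edgeShift [] [e] = C G.edgeShift [] [e] := by
  rw [Set.inter_eq_right]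
  intro x hx
  obtain ⟨h, rfl⟩ := G.mem_C_nil_singleton.1 hx
  exact ⟨h, rfl⟩

/-- The generators of the Leavitt path algebra inside the subshift algebra of the edge shift. -/
noncomputable def subshiftFamily : G.LeavittFamily (Subshift.algebra R G.edgeShift) where
  p S hS := Subshift.proj R G.edgeShift _ (G.inB_cylinder hG hS)
  s e := letter R G.edgeShift e
  sStar e := letterStar R G.edgeShift e
  p_empty := (proj_congr R G.cylinder_empty _ _).trans (proj_empty R)
  p_mul_p S S' hS hS' := (proj_mul_proj R _ _).trans (proj_congr R (G.cylinder_inter S S').symm _ _)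
  p_union S S' hS hS' := by
    rw [proj_congr R (G.cylinder_union S S') _
      ((G.inB_cylinder hG hS).union (G.inB_cylinder hG hS')), Subshift.proj_union R (G.inB_cylinder hG hS) (G.inB_cylinder hG hS')]
    congr 1
    exact proj_congr R (G.cylinder_inter S S').symm _ _
  source_s e := by
    -- Writing s_e = (s_e s_e^*) s_e puts the projection of C(ω, e) in front, and this set is
    -- contained in the cylinder of s(e).
    rw [← letter_mul_letterStar_mul_letter, G.letter_mul_letterStar R hG, ← mul_assoc,
      proj_mul_proj]
    congr 1
    exact proj_congr R (G.cylinder_source_inter_C e) _ _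
  s_range e := by
    rw [← G.letterStar_mul_letter R hG, ← mul_assoc, letter_mul_letterStar_mul_letter]
  range_sStar e := by
    rw [← G.letterStar_mul_letter R hG, letterStar_mul_letter_mul_letterStar]
  sStar_source e := by
    rw [← letterStar_mul_letter_mul_letterStar, mul_assoc (letterStar R G.edgeShift e),
      G.letter_mul_letterStar R hG, mul_assoc, proj_mul_proj]
    congr 1
    exact proj_congr R ((Set.inter_comm _ _).trans (G.cylinder_source_inter_C e)) _ _
  sStar_s_same e := G.letterStar_mul_letter R hG e
  sStar_s_ne e f h := by
    calc
      -- Inserting s_e s_e^* and s_f s_f^* exposes the projections of the disjoint sets C(ω, e) and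
      -- C(ω, f).
      _ = letterStar R G.edgeShift e * ((letter R G.edgeShift e * letterStar R G.edgeShift e) *
          (letter R G.edgeShift f * letterStar R G.edgeShift f)) * letter R G.edgeShift f := by
        refine (congrArg₂ (· * ·) (letterStar_mul_letter_mul_letterStar R e).symm
          (letter_mul_letterStar_mul_letter R f).symm).trans ?_
        simp only [mul_assoc]
      _ = 0 := by
        rw [G.letter_mul_letterStar R hG, G.letter_mul_letterStar R hG, proj_mul_proj,
          proj_congr R (G.C_nil_singleton_inter_eq_empty h) _ .empty, Subshift.proj_empty,
          mul_zero, zero_mul]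
  vertex x h := by
    rw [proj_congr R (G.cylinder_singleton x h.2) _
      (inB_biUnion _ _ fun e _ => G.inB_C_nil_singleton hG e),
      proj_biUnion R h.2.toFinset _ (G.inB_C_nil_singleton hG)
        fun _ _ => G.C_nil_singleton_inter_eq_empty]
    exact Finset.sum_congr rfl fun e _ => (G.letter_mul_letterStar R hG e).symm

theorem projC_subshiftFamily {α β : List E} (hα : α ∈ language G.edgeShift)
    (hβ : β ∈ language G.edgeShift) (h : ¬(α = [] ∧ β = [])) :
    (G.subshiftFamily R hG).projC α β =
      Subshift.proj R G.edgeShift (C G.edgeShift α β) (.basic α β hα hβ h) := by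
  rcases α with _ | ⟨a, l⟩
  · rcases β with _ | ⟨b, m⟩
    · exact absurd ⟨rfl, rfl⟩ h
    · rw [LeavittFamily.projC, LeavittFamily.corner_cons, LeavittFamily.wordProd_mul_p]
      exact wordProd_empty_word R hβ hα
  · have hrange := (G.subshiftFamily R hG).revWordProd_mul_wordProd hα
    rcases β with _ | ⟨b, m⟩
    · rw [LeavittFamily.projC, LeavittFamily.corner, ← hrange]
      exact wordProd_word_empty R hα hβ
    · rw [LeavittFamily.projC, LeavittFamily.corner_cons, ← hrange, ← mul_assoc]
      exact wordProd_word_word R hα hβ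

/-- Along an expression for S, each operation on values is matched by a relation among projections
in the subshift algebra. This shows that the composite on the subshift algebra fixes every
projection. -/
theorem LeavittFamily.map_eq_proj_of_represents {T : Type*} [NonUnitalRing T]
    (F : G.LeavittFamily T) (φ : T →ₙ+* Subshift.algebra R G.edgeShift)
    (hφ : F.map φ = G.subshiftFamily R hG) {S : Set (Stream' E)} {x : T}
    (h : F.Represents S x) : ∃ hS, φ x = Subshift.proj R G.edgeShift S hS := by
  unfold Represents at h
  induction h with
  | basic q =>
    obtain ⟨⟨α, β⟩, hα, hβ, hne⟩ := q
    refine ⟨.basic α β hα hβ hne, ?_⟩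
    rw [← G.projC_subshiftFamily R hG hα hβ hne, ← hφ]
    rcases α with _ | ⟨a, l⟩
    · rcases β with _ | ⟨b, m⟩
      · exact absurd ⟨rfl, rfl⟩ hne
      · exact (F.corner_map φ _ _).symm
    · exact (F.corner_map φ _ _).symm
  | empty => exact ⟨.empty, by rw [map_zero, Subshift.proj_empty]⟩
  | union _ _ h₁ h₂ =>
    obtain ⟨hS, h₁⟩ := h₁
    obtain ⟨hS', h₂⟩ := h₂
    exact ⟨hS.union hS', by rw [map_sub, map_add, map_mul, h₁, h₂, proj_mul_proj,
      Subshift.proj_union]⟩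
  | inter _ _ h₁ h₂ =>
    obtain ⟨hS, h₁⟩ := h₁
    obtain ⟨hS', h₂⟩ := h₂
    exact ⟨hS.inter hS', by rw [map_mul, h₁, h₂, proj_mul_proj]⟩
  | sdiff _ _ h₁ h₂ =>
    obtain ⟨hS, h₁⟩ := h₁
    obtain ⟨hS', h₂⟩ := h₂
    exact ⟨hS.sdiff hS', by rw [map_sub, map_mul, h₁, h₂, proj_sdiff]⟩

end Ultragraph

/-! ### The isomorphism. -/

theorem mainTheorem10 {R : Type u} [CommRing R] {V : Type v} {E : Type w} (G : Ultragraph V E)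
    (hG : ∀ x : V, G.IsRegular x) :
    ∃ φ : Subshift.algebra R G.edgeShift →ₙₐ[R] G.leavittPathAlgebra R,
      Function.Bijective φ := by
  let F := G.leavittFamily R
  let φ : Subshift.algebra R G.edgeShift →ₙₐ[R] G.leavittPathAlgebra R := F.subshiftHom hG R
  let ψ : G.leavittPathAlgebra R →ₙₐ[R] Subshift.algebra R G.edgeShift :=
    (G.subshiftFamily R hG).leavittHom R
  have hφ : ∀ x, φ (PresentedAlg.mk _ (FreeNonUnitalAlg.gen R x)) = F.subshiftGen x :=
    F.subshiftHom_gen hG R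
  have hψ : ∀ x, ψ (PresentedAlg.mk _ (FreeNonUnitalAlg.gen R x)) =
      (G.subshiftFamily R hG).leavittGen x := (G.subshiftFamily R hG).leavittHom_gen R
  have hmap : F.map (ψ : G.leavittPathAlgebra R →ₙ+* Subshift.algebra R G.edgeShift) =
      G.subshiftFamily R hG := by
    rw [Ultragraph.LeavittFamily.mk.injEq]
    exact ⟨funext fun S => funext fun hS => hψ (.proj S hS), funext fun e => hψ (.s e),
      funext fun e => hψ (.sStar e)⟩
  have h₁ : ψ.comp φ = NonUnitalAlgHom.id R _ := by
    refine PresentedAlg.hom_ext fun x => ?_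
    rw [NonUnitalAlgHom.comp_apply, hφ]
    rcases x with ⟨S, hS⟩ | a | a
    · obtain ⟨_, h⟩ := F.map_eq_proj_of_represents G R hG _ hmap (F.represents_proj hS)
      exact h
    · exact hψ (.s a)
    · exact hψ (.sStar a)
  have h₂ : φ.comp ψ = NonUnitalAlgHom.id R _ := by
    refine PresentedAlg.hom_ext fun x => ?_
    rw [NonUnitalAlgHom.comp_apply, hψ]
    rcases x with ⟨S, hS⟩ | e | e
    · exact (hφ (.proj _ _)).trans (F.proj_cylinder hG hS)
    · exact hφ (.s e)
    · exact hφ (.sStar e)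
  exact ⟨φ, Function.bijective_iff_has_inverse.2 ⟨ψ, DFunLike.congr_fun h₁, DFunLike.congr_fun h₂⟩⟩
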